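/- Let $n\ge 2$ be an integer and let $p\ge 1$ be a real number. Let $\mathbb T^n=\mathbb R^n/\mathbb Z^n$ be the flat torus with the metric $\varrho(x,y)=\bigl(\sum_{k=1}^n \min_{m\in\mathbb Z}|x_k-y_k-m|^2\bigr)^{1/2}$, and let $\mathcal W_p(\mathbb T^n)$ be the set of Borel probability measures on $\mathbb T^n$ with the $p$-Wasserstein distance $$d_{\mathcal W_p}(\mu,\nu)=\Bigl(\inf_{\pi}\int_{\mathbb T^n\times\mathbb T^n}\varrho(x,y)^p\,\mathrm d\pi(x,y)\Bigr)^{1/p},$$ where the infimum runs over all couplings $\pi$ of $\mu$ and $\nu$, that is, Borel probability measures on $\mathbb T^n\times\mathbb T^n$ with marginals $\mu$ and $\nu$. For a metric space $Y$ let $\mathrm{Isom}(Y)$ be the group of distance preserving bijections $Y\to Y$. For $\psi\in\mathrm{Isom}(\mathbb T^n)$ let $\psi_\#\mu$ be the push-forward, $(\psi_\#\mu)(A)=\mu(\psi^{-1}[A])$ for Borel sets $A$. Then $\mathcal W_p(\mathbb T^n)$ is isometrically rigid: the group homomorphism $\#\colon\mathrm{Isom}(\mathbb T^n)\to\mathrm{Isom}(\mathcal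 W_p(\mathbb T^n))$, $\psi\mapsto\psi_\#$, is surjective, that is, every isometry $\Phi$ of $\mathcal W_p(\mathbb T^n)$ has the form $\Phi=\psi_\#$ for some isometry $\psi$ of $\mathbb T^n$. The homomorphism $\#$ is also injective, hence $\mathrm{Isom}(\mathcal W_p(\mathbb T^n))\cong\mathrm{Isom}(\mathbb T^n)$. -/

import Mathlib

open MeasureTheory
open scoped ENNReal

noncomputable section

/-- The flat torus `ℝⁿ / ℤⁿ`, realised as the product of `n` copies of the circle `ℝ / ℤ` (with the
quotient distance: `|t - round t|` for two points that differ by `t` mod `1`), with the `ℓ²` product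
metric and its Borel `σ`-algebra. -/
abbrev FlatTorus (n : ℕ) : Type := PiLp 2 (fun _ : Fin n => UnitAddCircle)

section Wasserstein

variable {X : Type*} [MetricSpace X] [MeasurableSpace X]

/-- `π` is a coupling of `μ` and `ν`: a measure on `X × X` with marginals `μ` and `ν`
(so, automatically, a probability measure if `μ` and `ν` are). -/
def IsCoupling (π : Measure (X × X)) (μ ν : Measure X) : Prop :=
  π.map Prod.fst = μ ∧ π.map Prod.snd = ν

/-- The optimal transport cost `inf_π ∫ d(x, y)^p dπ(x, y)`, over all couplings `π` of `μ`, `ν`. -/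
def transportCost (p : ℝ) (μ ν : Measure X) : ℝ≥0∞ :=
  ⨅ (π : Measure (X × X)) (_ : IsCoupling π μ ν), ∫⁻ z, edist z.1 z.2 ^ p ∂π

theorem transportCost_map_le [BorelSpace X] (p : ℝ) (ψ : X ≃ᵢ X) (μ ν : Measure X) :
    transportCost p (μ.map ψ) (ν.map ψ) ≤ transportCost p μ ν := by
  refine le_iInf₂ fun π hπ => ?_
  have hψ : Measurable ψ := ψ.continuous.measurable
  let e : X × X ≃ᵐ X × X :=
    ψ.toHomeomorph.toMeasurableEquiv.prodCongr ψ.toHomeomorph.toMeasurableEquiv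
  have hc : IsCoupling (π.map e) (μ.map ψ) (ν.map ψ) := by
    constructor
    · rw [← hπ.1, Measure.map_map measurable_fst e.measurable, Measure.map_map hψ measurable_fst]
      rfl
    · rw [← hπ.2, Measure.map_map measurable_snd e.measurable, Measure.map_map hψ measurable_snd]
      rfl
  refine (iInf₂_le (π.map e) hc).trans (le_of_eq ?_)
  rw [lintegral_map_equiv]
  exact lintegral_congr fun z => congrArg (· ^ p) (ψ.edist_eq z.1 z.2)

theorem transportCost_map [BorelSpace X] (p : ℝ) (ψ : X ≃ᵢ X) (μ ν : Measure X) :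
    transportCost p (μ.map ψ) (ν.map ψ) = transportCost p μ ν := by
  refine le_antisymm (transportCost_map_le p ψ μ ν) ?_
  have h := transportCost_map_le p ψ.symm (μ.map ψ) (ν.map ψ)
  have hψ : Measurable ψ := ψ.continuous.measurable
  have hψ' : Measurable ψ.symm := ψ.symm.continuous.measurable
  rwa [Measure.map_map hψ' hψ, Measure.map_map hψ' hψ, ψ.symm_comp_self, Measure.map_id,
    Measure.map_id] at h

/-- The `p`-Wasserstein space over `X`: Borel probability measures with finite `p`-th moments. -/
def WassersteinSpace (p : ℝ) (X : Type*) [MetricSpace X] [MeasurableSpace X] : Type _ :=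
  {μ : ProbabilityMeasure X // ∀ x₀ : X, ∫⁻ x, edist x x₀ ^ p ∂(μ : Measure X) < ∞}

namespace WassersteinSpace

variable {p : ℝ}

/-- The underlying measure of a point of the Wasserstein space. -/
def toMeasure (μ : WassersteinSpace p X) : Measure X := (μ.1 : Measure X)

theorem toMeasure_injective : Function.Injective (toMeasure : WassersteinSpace p X → Measure X) :=
  fun _ _ h => Subtype.ext (Subtype.ext h)

/-- The `p`-Wasserstein distance `(inf_π ∫ d(x, y)^p dπ(x, y))^(1/p)`. For `p ≥ 1` the finiteness of
the `p`-th moments makes the cost finite, so `toReal` loses nothing. -/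
instance instDist : Dist (WassersteinSpace p X) :=
  ⟨fun μ ν => ((transportCost p μ.toMeasure ν.toMeasure) ^ (1 / p)).toReal⟩

theorem dist_def (μ ν : WassersteinSpace p X) :
    dist μ ν = ((transportCost p μ.toMeasure ν.toMeasure) ^ (1 / p)).toReal := rfl

/-- The isometry group of the Wasserstein space: its distance preserving bijections. -/
def isometryGroup (p : ℝ) (X : Type*) [MetricSpace X] [MeasurableSpace X] :
    Subgroup (Equiv.Perm (WassersteinSpace p X)) where
  carrier := {Φ | ∀ μ ν, dist (Φ μ) (Φ ν) = dist μ ν}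
  one_mem' := fun _ _ => rfl
  mul_mem' := fun {Φ Ψ} hΦ hΨ μ ν => (hΦ (Ψ μ) (Ψ ν)).trans (hΨ μ ν)
  inv_mem' := fun {Φ} hΦ μ ν => by
    have h := hΦ (Φ⁻¹ μ) (Φ⁻¹ ν)
    have e : ∀ κ, Φ (Φ⁻¹ κ) = κ := Φ.apply_symm_apply
    rw [e, e] at h
    exact h.symm

variable [BorelSpace X]

/-- The push-forward `ψ_# μ` of a point `μ` of the Wasserstein space under an isometry `ψ` of `X`,
`(ψ_# μ)(A) = μ(ψ⁻¹ A)`. -/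
def pushforward (ψ : X ≃ᵢ X) (μ : WassersteinSpace p X) : WassersteinSpace p X :=
  ⟨μ.1.map ψ.continuous.measurable.aemeasurable, fun x₀ => by
    have h := μ.2 (ψ.symm x₀)
    change ∫⁻ x, edist x x₀ ^ p ∂(μ.1 : Measure X).map ψ.toHomeomorph.toMeasurableEquiv < ∞
    rw [lintegral_map_equiv]
    refine lt_of_eq_of_lt (lintegral_congr fun x => ?_) h
    have e := ψ.edist_eq x (ψ.symm x₀)
    rw [ψ.apply_symm_apply] at e
    exact congrArg (· ^ p) e⟩

theorem toMeasure_pushforward (ψ : X ≃ᵢ X) (μ : WassersteinSpace p X) :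
    (pushforward ψ μ).toMeasure = μ.toMeasure.map ψ := rfl

theorem pushforward_one (μ : WassersteinSpace p X) : pushforward 1 μ = μ :=
  toMeasure_injective (by
    rw [toMeasure_pushforward]
    exact Measure.map_id)

theorem pushforward_mul (ψ φ : X ≃ᵢ X) (μ : WassersteinSpace p X) :
    pushforward (ψ * φ) μ = pushforward ψ (pushforward φ μ) :=
  toMeasure_injective (by
    simp only [toMeasure_pushforward]
    rw [Measure.map_map ψ.continuous.measurable φ.continuous.measurable]
    rfl)

/-- The push-forward operation `ψ ↦ ψ_#`, as a group homomorphism `Isom(X) → Isom(W_p(X))`. -/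
def pushforwardHom (p : ℝ) (X : Type*) [MetricSpace X] [MeasurableSpace X] [BorelSpace X] :
    (X ≃ᵢ X) →* isometryGroup p X where
  toFun ψ := ⟨{ toFun := pushforward ψ
                invFun := pushforward ψ⁻¹
                left_inv := fun μ => by rw [← pushforward_mul, inv_mul_cancel, pushforward_one]
                right_inv := fun μ => by rw [← pushforward_mul, mul_inv_cancel, pushforward_one] },
    fun μ ν => by
      simp only [Equiv.coe_fn_mk, dist_def, toMeasure_pushforward, transportCost_map]⟩
  map_one' := Subtype.ext (Equiv.ext pushforward_one)
  map_mul' ψ φ := Subtype.ext (Equiv.ext (pushforward_mul ψ φ))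

/-- `W_p(X)` is isometrically rigid: each of its isometries is the push-forward of an isometry of
`X`. -/
def IsometricallyRigid (p : ℝ) (X : Type*) [MetricSpace X] [MeasurableSpace X] [BorelSpace X] :
    Prop :=
  Function.Surjective (pushforwardHom p X)

end WassersteinSpace
end Wasserstein
end

/-! Call `x + 1/2` in all coordinates the antipode of `x`: the unique point at maximal distance from
`x`. If two measures are at maximal cost, every coupling must be concentrated on antipodal pairs,
the product coupling included, so both measures are Dirac masses. Isometries therefore permute Dirac
masses, and this permutation is an isometry `ψ` of the torus. After composition with the
push-forward of `ψ⁻¹`, it remains to show that an isometry `F` fixing every Dirac mass is the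
identity. Such an `F` preserves all potentials `x ↦ ∫ d(y, x)^p dμ(y)`.

The core is a detection principle (`IsDiracFixing.measure_eq`). Suppose `d(y, x')^p - d(y, x)^p ≤
M`, with equality exactly for `y ∈ A`. Sending all of `μ` to `x'` and then redirecting mass `t` to
`x` saves at most `t M`, and saves exactly that precisely when `t ≤ μ(A)`. So if the measures `t δ_x
+ (1 - t) δ_x'` are fixed by `F`, then `F` preserves the mass of `A`.

Fixed two-point measures come from squares: `x` and its half-translates in two coordinates `i`, `j`.
Potentials show that `F` preserves the measures carried by the square together with their two
marginals, which leaves one free parameter. A metric argument removes it for the diagonal measures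
with `t ≠ 1/2` (`IsDiracFixing.fixes_diag`).

For `x'` opposite to `x` in such a square, the cost difference is largest where `y` agrees with `x`
at `i` and `j`; there it equals `(1/2 + r)^(p/2) - r^(p/2)`, with `r` the squared distance in the
other coordinates. This decreases in `r` for `p < 2` and increases for `p > 2`, so `A` is a single
point. For `p = 2` it is constant and `A` is only a subtorus of codimension two; the masses of these
subtori show that `t δ_x + (1 - t) δ_x'` is fixed for antipodal `x`, `x'` too, and a second
detection isolates `{x}`. In every case `F` preserves the masses of points, hence fixes finitely
supported measures, and these are dense. -/

set_option linter.unusedSectionVars false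

/-! ### Couplings and elementary bounds for the transport cost -/

section Transport

variable {X : Type*} [MetricSpace X] [MeasurableSpace X] {p : ℝ}

theorem IsCoupling.isProbabilityMeasure {π : Measure (X × X)} {μ ν : Measure X}
    [IsProbabilityMeasure μ] (h : IsCoupling π μ ν) : IsProbabilityMeasure π := by
  constructor
  have : (π.map Prod.fst) Set.univ = 1 := by rw [h.1]; exact measure_univ
  rwa [Measure.map_apply measurable_fst MeasurableSet.univ] at this

theorem IsCoupling.add {π π' : Measure (X × X)} {μ ν μ' ν' : Measure X}
    (h : IsCoupling π μ ν) (h' : IsCoupling π' μ' ν') :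
    IsCoupling (π + π') (μ + μ') (ν + ν') :=
  ⟨by rw [Measure.map_add _ _ measurable_fst, h.1, h'.1],
    by rw [Measure.map_add _ _ measurable_snd, h.2, h'.2]⟩

theorem IsCoupling.ae_fst {π : Measure (X × X)} {μ ν : Measure X} (h : IsCoupling π μ ν)
    {P : X → Prop} (hP : ∀ᵐ x ∂μ, P x) : ∀ᵐ z ∂π, P z.1 := by
  rw [← h.1] at hP
  exact ae_of_ae_map measurable_fst.aemeasurable hP

theorem IsCoupling.ae_snd {π : Measure (X × X)} {μ ν : Measure X} (h : IsCoupling π μ ν)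
    {P : X → Prop} (hP : ∀ᵐ x ∂ν, P x) : ∀ᵐ z ∂π, P z.2 := by
  rw [← h.2] at hP
  exact ae_of_ae_map measurable_snd.aemeasurable hP

theorem IsCoupling.measure_fst {π : Measure (X × X)} {μ ν : Measure X} (h : IsCoupling π μ ν)
    {A : Set X} (hA : MeasurableSet A) : π (Prod.fst ⁻¹' A) = μ A := by
  rw [← h.1, Measure.map_apply measurable_fst hA]

theorem IsCoupling.measure_snd {π : Measure (X × X)} {μ ν : Measure X} (h : IsCoupling π μ ν)
    {A : Set X} (hA : MeasurableSet A) : π (Prod.snd ⁻¹' A) = ν A := by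
  rw [← h.2, Measure.map_apply measurable_snd hA]

theorem transportCost_le {π : Measure (X × X)} {μ ν : Measure X} (h : IsCoupling π μ ν) :
    transportCost p μ ν ≤ ∫⁻ z, edist z.1 z.2 ^ p ∂π :=
  iInf₂_le π h

theorem exists_coupling_lt {μ ν : Measure X} {c : ℝ≥0∞} (h : transportCost p μ ν < c) :
    ∃ π, IsCoupling π μ ν ∧ ∫⁻ z, edist z.1 z.2 ^ p ∂π < c := by
  simpa only [transportCost, iInf_lt_iff, exists_prop] using h

theorem transportCost_add_le (μ ν μ' ν' : Measure X) :
    transportCost p (μ + μ') (ν + ν') ≤ transportCost p μ ν + transportCost p μ' ν' := by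
  refine ENNReal.le_of_forall_pos_le_add fun ε hε h => ?_
  obtain ⟨h1, h2⟩ := ENNReal.add_lt_top.1 h
  have hε' : (ε / 2 : ℝ≥0∞) ≠ 0 := by simp [hε.ne']
  obtain ⟨π, hπ, h1⟩ := exists_coupling_lt (ENNReal.lt_add_right h1.ne hε')
  obtain ⟨π', hπ', h2⟩ := exists_coupling_lt (ENNReal.lt_add_right h2.ne hε')
  refine (transportCost_le (hπ.add hπ')).trans ?_
  rw [lintegral_add_measure]
  refine (add_le_add h1.le h2.le).trans (le_of_eq ?_)
  rw [add_add_add_comm, ENNReal.add_halves]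

variable [BorelSpace X] [SecondCountableTopology X]

theorem measurable_edist_rpow : Measurable fun z : X × X => edist z.1 z.2 ^ p :=
  (measurable_edist (α := X)).pow_const p

theorem measurable_edist_rpow_left (x : X) : Measurable fun y : X => edist y x ^ p :=
  (measurable_edist_left).pow_const p

theorem transportCost_self (hp : 0 < p) (μ : Measure X) : transportCost p μ μ = 0 := by
  have hm : Measurable fun x : X => (x, x) := measurable_id.prodMk measurable_id
  have hc : IsCoupling (μ.map fun x => (x, x)) μ μ := by
    constructor
    · rw [Measure.map_map measurable_fst hm]; exact Measure.map_id
    · rw [Measure.map_map measurable_snd hm]; exact Measure.map_id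
  refine le_antisymm ((transportCost_le hc).trans ?_) zero_le
  rw [lintegral_map measurable_edist_rpow hm]
  simp [hp]

theorem transportCost_map_right_le (μ : Measure X) {q : X → X} (hq : Measurable q) :
    transportCost p μ (μ.map q) ≤ ∫⁻ x, edist x (q x) ^ p ∂μ := by
  have hm : Measurable fun x : X => (x, q x) := measurable_id.prodMk hq
  have hc : IsCoupling (μ.map fun x => (x, q x)) μ (μ.map q) := by
    constructor
    · rw [Measure.map_map measurable_fst hm]; exact Measure.map_id
    · rw [Measure.map_map measurable_snd hm]; rfl
  refine (transportCost_le hc).trans ?_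
  rw [lintegral_map measurable_edist_rpow hm]

theorem transportCost_smul_dirac_right_le (μ : Measure X) (x : X) :
    transportCost p μ (μ Set.univ • Measure.dirac x) ≤ ∫⁻ y, edist y x ^ p ∂μ := by
  have h := transportCost_map_right_le (p := p) μ (measurable_const (a := x))
  rwa [Measure.map_const] at h

theorem transportCost_smul_dirac_smul_dirac_le (c : ℝ≥0∞) (x y : X) :
    transportCost p (c • Measure.dirac x) (c • Measure.dirac y) ≤ c * edist x y ^ p := by
  have h := transportCost_smul_dirac_right_le (p := p) (c • Measure.dirac x) y
  rw [lintegral_smul_measure, lintegral_dirac' _ (measurable_edist_rpow_left y)] at h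
  simpa using h

theorem transportCost_dirac_right (μ : Measure X) [IsProbabilityMeasure μ] (x : X) :
    transportCost p μ (Measure.dirac x) = ∫⁻ y, edist y x ^ p ∂μ := by
  refine le_antisymm ?_ (le_iInf₂ fun π hπ => ?_)
  · simpa using transportCost_smul_dirac_right_le (p := p) μ x
  · have h2 : ∀ᵐ z ∂π, z.2 = x := hπ.ae_snd (P := (· = x)) (
      (ae_dirac_iff (measurableSet_singleton x)).2 rfl)
    rw [← hπ.1, lintegral_map (measurable_edist_rpow_left x) measurable_fst]
    refine le_of_eq (lintegral_congr_ae ?_)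
    filter_upwards [h2] with z hz
    rw [hz]

theorem transportCost_dirac_dirac (x y : X) :
    transportCost p (Measure.dirac x) (Measure.dirac y) = edist x y ^ p := by
  rw [transportCost_dirac_right, lintegral_dirac' _ (measurable_edist_rpow_left y)]

theorem transportCost_le_prod (μ ν : Measure X) [IsProbabilityMeasure μ]
    [IsProbabilityMeasure ν] :
    transportCost p μ ν ≤ ∫⁻ z, edist z.1 z.2 ^ p ∂(μ.prod ν) :=
  transportCost_le ⟨by simp [Measure.map_fst_prod], by simp [Measure.map_snd_prod]⟩

/-- The mass that `A` gains has to enter it from outside, and each such move joins two distinct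
points of `Q`. -/
theorem mul_measure_sub_le_transportCost {μ ν : Measure X} [IsProbabilityMeasure μ]
    {Q A : Set X} (hμ : ∀ᵐ x ∂μ, x ∈ Q) (hν : ∀ᵐ x ∂ν, x ∈ Q) (hA : MeasurableSet A)
    {u : ℝ≥0∞} (hu : ∀ a ∈ Q, ∀ b ∈ Q, a ≠ b → u ≤ edist a b ^ p) :
    u * (ν A - μ A) ≤ transportCost p μ ν := by
  refine le_iInf₂ fun π hπ => ?_
  set S : Set (X × X) := Prod.snd ⁻¹' A \ Prod.fst ⁻¹' A with hS
  have hSm : MeasurableSet S := (measurable_snd hA).diff (measurable_fst hA)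
  have h1 : ν A - μ A ≤ π S := by
    rw [← hπ.measure_fst hA, ← hπ.measure_snd hA]
    exact le_measure_sdiff
  calc u * (ν A - μ A) ≤ u * π S := by gcongr
    _ = ∫⁻ z, S.indicator (fun _ => u) z ∂π := by rw [lintegral_indicator_const hSm]
    _ ≤ ∫⁻ z, edist z.1 z.2 ^ p ∂π := by
        refine lintegral_mono_ae ?_
        filter_upwards [hπ.ae_fst hμ, hπ.ae_snd hν] with z h1 h2
        by_cases hz : z ∈ S
        · rw [Set.indicator_of_mem hz]
          refine hu _ h1 _ h2 fun h => hz.2 ?_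
          have := hz.1
          simpa [h] using this
        · rw [Set.indicator_of_notMem hz]; exact zero_le

/-! ### Compact base: finiteness, density of finite supports, separation -/

variable [CompactSpace X]

theorem edist_rpow_le_diam (hp : 0 ≤ p) (x y : X) :
    edist x y ^ p ≤ Metric.ediam (Set.univ : Set X) ^ p :=
  ENNReal.rpow_le_rpow (Metric.edist_le_ediam_of_mem (Set.mem_univ x) (Set.mem_univ y)) hp

theorem ediam_univ_rpow_ne_top (hp : 0 ≤ p) : Metric.ediam (Set.univ : Set X) ^ p ≠ ∞ :=
  ENNReal.rpow_ne_top_of_nonneg hp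
    (Metric.isBounded_of_compactSpace (s := (Set.univ : Set X))).ediam_ne_top

theorem lintegral_edist_rpow_ne_top (hp : 0 ≤ p) (μ : Measure X) [IsFiniteMeasure μ] (x : X) :
    ∫⁻ y, edist y x ^ p ∂μ ≠ ∞ := by
  refine ne_top_of_le_ne_top ?_ (lintegral_mono fun y => edist_rpow_le_diam hp y x)
  rw [lintegral_const]
  exact ENNReal.mul_ne_top (ediam_univ_rpow_ne_top hp) (measure_ne_top _ _)

theorem transportCost_ne_top (hp : 0 ≤ p) (μ ν : Measure X) [IsProbabilityMeasure μ]
    [IsProbabilityMeasure ν] : transportCost p μ ν ≠ ∞ := by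
  refine ne_top_of_le_ne_top ?_ ((transportCost_le_prod μ ν).trans
    (lintegral_mono fun z => edist_rpow_le_diam hp z.1 z.2))
  rw [lintegral_const]
  exact ENNReal.mul_ne_top (ediam_univ_rpow_ne_top hp) (measure_ne_top _ _)

/-- Finitely supported measures are dense for the transport cost. -/
theorem exists_simpleFunc_transportCost_map_le (hp : 0 < p) (μ : Measure X)
    [IsProbabilityMeasure μ] {ε : ℝ≥0∞} (hε : 0 < ε) (hε' : ε ≠ ∞) :
    ∃ q : SimpleFunc X X, transportCost p μ (μ.map q) ≤ ε := by
  have : Nonempty X := μ.nonempty_of_neZero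
  set r : ℝ≥0∞ := ε ^ (1 / p)
  have hr : 0 < r := ENNReal.rpow_pos hε hε'
  have hcov := isCompact_univ.elim_directed_cover (X := X)
    (fun N : ℕ => ⋃ k ≤ N, Metric.eball (TopologicalSpace.denseSeq X k) r)
    (fun N => isOpen_biUnion fun _ _ => Metric.isOpen_eball) (by
      intro x _
      obtain ⟨k, hk⟩ := (TopologicalSpace.denseRange_denseSeq X).exists_mem_open
        (Metric.isOpen_eball (x := x) (ε := r)) ⟨x, Metric.mem_eball_self hr⟩
      simp only [Set.mem_iUnion]
      exact ⟨k, k, le_rfl, Metric.mem_eball_comm.1 hk⟩)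
    (directed_of_isDirected_le fun a b hab => Set.biUnion_subset_biUnion_left
      fun k (hk : k ≤ a) => hk.trans hab)
  obtain ⟨N, hN⟩ := hcov
  refine ⟨SimpleFunc.nearestPt (TopologicalSpace.denseSeq X) N, ?_⟩
  refine (transportCost_map_right_le μ (SimpleFunc.measurable _)).trans ?_
  have hle : ∀ x : X,
      edist x (SimpleFunc.nearestPt (TopologicalSpace.denseSeq X) N x) ^ p ≤ ε := by
    intro x
    have hx := hN (Set.mem_univ x)
    simp only [Set.mem_iUnion] at hx
    obtain ⟨k, hk, hx⟩ := hx
    have h1 := SimpleFunc.edist_nearestPt_le (TopologicalSpace.denseSeq X) x hk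
    have h2 : edist x (SimpleFunc.nearestPt (TopologicalSpace.denseSeq X) N x) ≤ r := by
      rw [edist_comm]
      refine h1.trans ?_
      rw [edist_comm]
      exact (Metric.mem_eball.1 hx).le
    calc _ ≤ r ^ p := ENNReal.rpow_le_rpow h2 hp.le
      _ = ε := by
        rw [← ENNReal.rpow_mul, one_div_mul_cancel hp.ne', ENNReal.rpow_one]
  calc _ ≤ ∫⁻ _, ε ∂μ := lintegral_mono hle
    _ = ε := by simp

/-- Uniform continuity bounds `|f x - f y|` by `ε` at short range; at long range `2‖f‖` is absorbed
into a multiple of `d(x, y)^p`. Integration against almost optimal couplings does the rest. -/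
theorem abs_integral_sub_le_transportCost (f : C(X, ℝ)) (hp : 0 < p) {ε : ℝ} (hε : 0 < ε) :
    ∃ M : ℝ, 0 ≤ M ∧ ∀ μ ν : Measure X, IsProbabilityMeasure μ → IsProbabilityMeasure ν →
      |∫ x, f x ∂μ - ∫ x, f x ∂ν| ≤ ε + M * (transportCost p μ ν).toReal := by
  obtain ⟨δ, hδ, hf⟩ := Metric.uniformContinuous_iff.1
    (CompactSpace.uniformContinuous_of_continuous f.continuous) ε hε
  have hM : 0 ≤ 2 * ‖f‖ / δ ^ p := by positivity
  have key : ∀ x y, |f x - f y| ≤ ε + 2 * ‖f‖ / δ ^ p * dist x y ^ p := by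
    intro x y
    rcases lt_or_ge (dist x y) δ with h | h
    · have := (hf h).le
      rw [Real.dist_eq] at this
      have : 0 ≤ 2 * ‖f‖ / δ ^ p * dist x y ^ p := by positivity
      linarith
    · have h1 : |f x - f y| ≤ 2 * ‖f‖ := by
        have := norm_sub_le (f x) (f y)
        rw [Real.norm_eq_abs] at this
        linarith [f.norm_coe_le_norm x, f.norm_coe_le_norm y]
      have h2 : δ ^ p ≤ dist x y ^ p := Real.rpow_le_rpow hδ.le h hp.le
      have h3 : 0 < δ ^ p := Real.rpow_pos_of_pos hδ p
      have h4 : 2 * ‖f‖ = 2 * ‖f‖ / δ ^ p * δ ^ p := by field_simp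
      have := mul_le_mul_of_nonneg_left h2 hM
      linarith
  refine ⟨_, hM, fun μ ν hμ hν => ?_⟩
  set M := 2 * ‖f‖ / δ ^ p
  have hC := transportCost_ne_top hp.le μ ν
  refine le_of_forall_pos_le_add fun η hη => ?_
  -- The summand `1` keeps the quotient meaningful when `M = 0`, that is, when `f = 0`.
  have hη' : 0 < η / (M + 1) := by positivity
  obtain ⟨π, hπ, hlt⟩ := exists_coupling_lt (p := p) (μ := μ) (ν := ν)
    (ENNReal.lt_add_right hC (b := ENNReal.ofReal (η / (M + 1))) (by simpa using hη'))
  have := hπ.isProbabilityMeasure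
  have hd : ∀ z : X × X, edist z.1 z.2 ^ p = ENNReal.ofReal (dist z.1 z.2 ^ p) := fun z => by
    rw [edist_dist, ENNReal.ofReal_rpow_of_nonneg dist_nonneg hp.le]
  have hi : ∀ g : X × X → ℝ, Continuous g → Integrable g π := fun g hg =>
    hg.integrable_of_hasCompactSupport (HasCompactSupport.of_compactSpace _)
  have hdc : Continuous fun z : X × X => dist z.1 z.2 ^ p :=
    (continuous_fst.dist continuous_snd).rpow_const fun _ => Or.inr hp.le
  have hI : ∫ z, dist z.1 z.2 ^ p ∂π = (∫⁻ z, edist z.1 z.2 ^ p ∂π).toReal := by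
    rw [integral_eq_lintegral_of_nonneg_ae (.of_forall fun _ => by positivity)
      hdc.aestronglyMeasurable]
    simp only [hd]
  have h1 : (∫⁻ z, edist z.1 z.2 ^ p ∂π).toReal ≤
      (transportCost p μ ν).toReal + η / (M + 1) := by
    refine (ENNReal.toReal_mono (by simp [hC]) hlt.le).trans ?_
    rw [ENNReal.toReal_add hC ENNReal.ofReal_ne_top, ENNReal.toReal_ofReal hη'.le]
  have h2 : ∫ x, f x ∂μ - ∫ x, f x ∂ν = ∫ z, (f z.1 - f z.2) ∂π := by
    rw [integral_sub (hi _ (by fun_prop)) (hi _ (by fun_prop)), ← hπ.1, ← hπ.2,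
      integral_map measurable_fst.aemeasurable f.continuous.aestronglyMeasurable,
      integral_map measurable_snd.aemeasurable f.continuous.aestronglyMeasurable]
  have h3 : |∫ x, f x ∂μ - ∫ x, f x ∂ν| ≤ ε + M * ∫ z, dist z.1 z.2 ^ p ∂π := by
    rw [h2]
    refine abs_integral_le_integral_abs.trans ?_
    calc _ ≤ ∫ z, (ε + M * dist z.1 z.2 ^ p) ∂π :=
          integral_mono (hi _ (by fun_prop)) (hi _ (by fun_prop)) fun z => key z.1 z.2
      _ = _ := by
          rw [integral_add (hi _ (by fun_prop)) (hi _ (by fun_prop)), integral_const_mul]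
          simp
  rw [hI] at h3
  have h4 : M * (η / (M + 1)) ≤ η := by
    rw [mul_div_assoc', div_le_iff₀ (by positivity)]
    nlinarith
  nlinarith [mul_le_mul_of_nonneg_left h1 hM]

/-- Common approximants force equality. Testing against continuous functions makes the triangle
inequality for the Wasserstein distance unnecessary. -/
theorem eq_of_transportCost_le (hp : 0 < p) {μ μ' : Measure X} [IsProbabilityMeasure μ]
    [IsProbabilityMeasure μ']
    (h : ∀ ε : ℝ≥0∞, 0 < ε → ε ≠ ∞ → ∃ ν : Measure X, IsProbabilityMeasure ν ∧
      transportCost p μ ν ≤ ε ∧ transportCost p μ' ν ≤ ε) : μ = μ' := by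
  refine ext_of_forall_integral_eq_of_IsFiniteMeasure fun f => ?_
  refine eq_of_abs_sub_le_all fun ε hε => ?_
  obtain ⟨M, hM, H⟩ := abs_integral_sub_le_transportCost (p := p)
    (f : C(X, ℝ)) hp (ε := ε / 4) (by positivity)
  have hη : 0 < ε / (4 * (M + 1)) := by positivity
  obtain ⟨ν, hν, h1, h2⟩ := h (ENNReal.ofReal (ε / (4 * (M + 1)))) (by simpa using hη)
    ENNReal.ofReal_ne_top
  have h1 := ENNReal.toReal_le_of_le_ofReal hη.le h1
  have h2 := ENNReal.toReal_le_of_le_ofReal hη.le h2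
  have h4 : M * (ε / (4 * (M + 1))) ≤ ε / 4 := by
    rw [mul_div_assoc', div_le_div_iff₀ (by positivity) (by positivity)]
    nlinarith
  have H1 := H μ ν inferInstance hν
  have H2 := H μ' ν inferInstance hν
  have h5 := mul_le_mul_of_nonneg_left h1 hM
  have h6 := mul_le_mul_of_nonneg_left h2 hM
  simp only [ContinuousMap.coe_coe] at H1 H2
  rw [abs_le] at H1 H2 ⊢
  constructor <;> linarith

/-- Only `μ` has to be carried by `S`: the masses of the points of `S` already add up to `1`, so
nothing is left for `μ'` elsewhere. -/
theorem measure_eq_of_singleton_eq {μ μ' : Measure X} [IsProbabilityMeasure μ]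
    [IsProbabilityMeasure μ'] {S : Set X} (hS : S.Finite) (hμ : ∀ᵐ x ∂μ, x ∈ S)
    (h : ∀ x ∈ S, μ {x} = μ' {x}) : μ = μ' := by
  have hsum : ∀ T ⊆ S, μ T = μ' T := fun T hT => by
    have hf := hS.subset hT
    rw [← hf.coe_toFinset, ← sum_measure_singleton, ← sum_measure_singleton]
    exact Finset.sum_congr rfl fun x hx => h x (hT (by simpa using hx))
  have hμ' : ∀ᵐ x ∂μ', x ∈ S :=
    (mem_ae_iff_prob_eq_one hS.measurableSet).2 <| by
      rw [← hsum S subset_rfl]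
      exact (mem_ae_iff_prob_eq_one hS.measurableSet).1 hμ
  have hinter : ∀ (κ : Measure X), (∀ᵐ x ∂κ, x ∈ S) → ∀ A : Set X, κ A = κ (A ∩ S) :=
    fun κ hκ A => measure_congr <| by
      filter_upwards [hκ] with x hx
      exact propext ⟨fun h => ⟨h, hx⟩, fun h => h.1⟩
  ext A _
  rw [hinter μ hμ, hinter μ' hμ', hsum _ Set.inter_subset_right]

end Transport

/-! ### Measures on the vertices of a square -/

section Square

variable {X : Type*} [MetricSpace X] [MeasurableSpace X] [BorelSpace X]
  [SecondCountableTopology X] {p : ℝ}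

theorem transportCost_pair_le (hp : 0 < p) (x y : X) {a b a' b' : ℝ} (ha : 0 ≤ a) (hb : 0 ≤ b)
    (ha' : 0 ≤ a') (hb' : 0 ≤ b') (h : a + b = a' + b') :
    transportCost p
      (ENNReal.ofReal a • Measure.dirac x + ENNReal.ofReal b • Measure.dirac y)
      (ENNReal.ofReal a' • Measure.dirac x + ENNReal.ofReal b' • Measure.dirac y) ≤
      ENNReal.ofReal |a - a'| * edist x y ^ p := by
  rcases le_total a a' with hle | hle
  · obtain ⟨e, he⟩ : ∃ e, e = a' - a := ⟨_, rfl⟩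
    have he0 : 0 ≤ e := by linarith
    have h1 : a' = a + e := by linarith
    have h2 : b = e + b' := by linarith
    rw [h2, ENNReal.ofReal_add he0 hb', h1, ENNReal.ofReal_add ha he0, add_smul, add_smul,
      add_assoc]
    refine (transportCost_add_le _ _ _ _).trans ?_
    rw [transportCost_self hp, zero_add]
    refine (transportCost_add_le _ _ _ _).trans ?_
    rw [transportCost_self hp, add_zero, edist_comm]
    refine (transportCost_smul_dirac_smul_dirac_le _ _ _).trans (le_of_eq ?_)
    congr 2
    rw [abs_of_nonpos] <;> linarith
  · obtain ⟨e, he⟩ : ∃ e, e = a - a' := ⟨_, rfl⟩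
    have he0 : 0 ≤ e := by linarith
    have h1 : a = a' + e := by linarith
    have h2 : b' = e + b := by linarith
    rw [h2, ENNReal.ofReal_add he0 hb, h1, ENNReal.ofReal_add ha' he0, add_smul, add_smul,
      add_assoc]
    refine (transportCost_add_le _ _ _ _).trans ?_
    rw [transportCost_self hp, zero_add]
    refine (transportCost_add_le _ _ _ _).trans ?_
    rw [transportCost_self hp, add_zero]
    refine (transportCost_smul_dirac_smul_dirac_le _ _ _).trans (le_of_eq ?_)
    congr 2
    rw [abs_of_nonneg] <;> linarith

/-- The four points `x₀₀, x₀₁, x₁₀, x₁₁` form a square whose sides and diagonals have `p`-th powers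
of lengths `s` and `d`, and they are the points at which the sum of the `p`-th powers of the
distances to some family of four points is maximal. -/
structure IsFarthestSquare (p s d : ℝ) (x₀₀ x₀₁ x₁₀ x₁₁ : X) : Prop where
  side_pos : 0 < s
  side_le_diag : s ≤ d
  edist_left : edist x₀₀ x₀₁ ^ p = ENNReal.ofReal s
  edist_right : edist x₁₀ x₁₁ ^ p = ENNReal.ofReal s
  edist_bot : edist x₀₀ x₁₀ ^ p = ENNReal.ofReal s
  edist_top : edist x₀₁ x₁₁ ^ p = ENNReal.ofReal s
  edist_diag : edist x₀₀ x₁₁ ^ p = ENNReal.ofReal d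
  edist_diag' : edist x₀₁ x₁₀ ^ p = ENNReal.ofReal d
  exists_farthest : ∃ (v : Fin 4 → X) (K : ℝ≥0∞), K ≠ ∞ ∧
    (∀ y, ∑ i, edist y (v i) ^ p ≤ K) ∧
    ∀ y, ∑ i, edist y (v i) ^ p = K ↔ y ∈ ({x₀₀, x₀₁, x₁₀, x₁₁} : Set X)

/-- A combination of four Dirac masses. -/
noncomputable def fourDirac (x₀₀ x₀₁ x₁₀ x₁₁ : X) (a b c d : ℝ) : Measure X :=
  (ENNReal.ofReal a • Measure.dirac x₀₀ + ENNReal.ofReal b • Measure.dirac x₀₁) +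
    (ENNReal.ofReal c • Measure.dirac x₁₀ + ENNReal.ofReal d • Measure.dirac x₁₁)

theorem isProbabilityMeasure_fourDirac (x₀₀ x₀₁ x₁₀ x₁₁ : X) {a b c d : ℝ} (ha : 0 ≤ a)
    (hb : 0 ≤ b) (hc : 0 ≤ c) (hd : 0 ≤ d) (h : a + b + (c + d) = 1) :
    IsProbabilityMeasure (fourDirac x₀₀ x₀₁ x₁₀ x₁₁ a b c d) := by
  constructor
  simp only [fourDirac, Measure.add_apply, Measure.smul_apply, measure_univ, smul_eq_mul, mul_one]
  rw [← ENNReal.ofReal_add ha hb, ← ENNReal.ofReal_add hc hd,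
    ← ENNReal.ofReal_add (by positivity) (by positivity), h, ENNReal.ofReal_one]

theorem ae_mem_fourDirac (x₀₀ x₀₁ x₁₀ x₁₁ : X) (a b c d : ℝ) :
    ∀ᵐ y ∂(fourDirac x₀₀ x₀₁ x₁₀ x₁₁ a b c d), y ∈ ({x₀₀, x₀₁, x₁₀, x₁₁} : Set X) := by
  have hm : MeasurableSet ({x₀₀, x₀₁, x₁₀, x₁₁} : Set X) := (Set.toFinite _).measurableSet
  have key : ∀ z ∈ ({x₀₀, x₀₁, x₁₀, x₁₁} : Set X), ∀ t : ℝ≥0∞,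
      ∀ᵐ y ∂(t • Measure.dirac z), y ∈ ({x₀₀, x₀₁, x₁₀, x₁₁} : Set X) := fun z hz t =>
    Measure.ae_smul_measure
      ((ae_dirac_iff (p := fun y => y ∈ ({x₀₀, x₀₁, x₁₀, x₁₁} : Set X)) hm).2 hz) t
  simp only [fourDirac, ae_add_measure_iff]
  exact ⟨⟨key _ (by simp) _, key _ (by simp) _⟩, key _ (by simp) _, key _ (by simp) _⟩

theorem lintegral_fourDirac (x₀₀ x₀₁ x₁₀ x₁₁ : X) (a b c d : ℝ) (x : X) :
    ∫⁻ y, edist y x ^ p ∂(fourDirac x₀₀ x₀₁ x₁₀ x₁₁ a b c d) =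
      (ENNReal.ofReal a * edist x₀₀ x ^ p + ENNReal.ofReal b * edist x₀₁ x ^ p) +
        (ENNReal.ofReal c * edist x₁₀ x ^ p + ENNReal.ofReal d * edist x₁₁ x ^ p) := by
  simp only [fourDirac, lintegral_add_measure, lintegral_smul_measure,
    lintegral_dirac' _ (measurable_edist_rpow_left x), smul_eq_mul]

namespace IsFarthestSquare

variable {s d : ℝ} {x₀₀ x₀₁ x₁₀ x₁₁ : X}

theorem diag_pos (h : IsFarthestSquare p s d x₀₀ x₀₁ x₁₀ x₁₁) : 0 < d :=
  h.side_pos.trans_le h.side_le_diag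

/-- This symmetry exchanges the ends of a diagonal, and so the weights `t` and `1 - t`. -/
theorem flip (h : IsFarthestSquare p s d x₀₀ x₀₁ x₁₀ x₁₁) :
    IsFarthestSquare p s d x₁₁ x₁₀ x₀₁ x₀₀ where
  side_pos := h.side_pos
  side_le_diag := h.side_le_diag
  edist_left := by rw [edist_comm, h.edist_right]
  edist_right := by rw [edist_comm, h.edist_left]
  edist_bot := by rw [edist_comm, h.edist_top]
  edist_top := by rw [edist_comm, h.edist_bot]
  edist_diag := by rw [edist_comm, h.edist_diag]
  edist_diag' := by rw [edist_comm, h.edist_diag']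
  exists_farthest := by
    obtain ⟨v, K, hK, h1, h2⟩ := h.exists_farthest
    refine ⟨v, K, hK, h1, fun y => (h2 y).trans ?_⟩
    simp only [Set.mem_insert_iff, Set.mem_singleton_iff]
    tauto

theorem side_le_edist (h : IsFarthestSquare p s d x₀₀ x₀₁ x₁₀ x₁₁) :
    ∀ a ∈ ({x₀₀, x₀₁, x₁₀, x₁₁} : Set X), ∀ b ∈ ({x₀₀, x₀₁, x₁₀, x₁₁} : Set X), a ≠ b →
      ENNReal.ofReal s ≤ edist a b ^ p := by
  have hsd := ENNReal.ofReal_le_ofReal h.side_le_diag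
  rintro a (rfl | rfl | rfl | rfl) b (rfl | rfl | rfl | rfl) hab <;>
    first
    | exact absurd rfl hab
    | (first | rw [h.edist_left] | rw [h.edist_right] | rw [h.edist_bot] | rw [h.edist_top])
    | rw [h.edist_diag]; exact hsd
    | rw [h.edist_diag']; exact hsd
    | (rw [edist_comm]
       first | rw [h.edist_left] | rw [h.edist_right] | rw [h.edist_bot] | rw [h.edist_top])
    | rw [edist_comm, h.edist_diag]; exact hsd
    | rw [edist_comm, h.edist_diag']; exact hsd

theorem distinct (h : IsFarthestSquare p s d x₀₀ x₀₁ x₁₀ x₁₁) (hp : 0 < p) :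
    x₀₀ ≠ x₀₁ ∧ x₀₀ ≠ x₁₀ ∧ x₀₀ ≠ x₁₁ ∧ x₀₁ ≠ x₁₀ ∧ x₀₁ ≠ x₁₁ ∧ x₁₀ ≠ x₁₁ := by
  have key : ∀ {x y : X} {t : ℝ}, 0 < t → edist x y ^ p = ENNReal.ofReal t → x ≠ y := by
    rintro x y t ht hxy rfl
    rw [edist_self, ENNReal.zero_rpow_of_pos hp, eq_comm, ENNReal.ofReal_eq_zero] at hxy
    linarith
  exact ⟨key h.side_pos h.edist_left, key h.side_pos h.edist_bot, key h.diag_pos h.edist_diag,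
    key h.diag_pos h.edist_diag', key h.side_pos h.edist_top, key h.side_pos h.edist_right⟩

theorem exists_eq_fourDirac (h : IsFarthestSquare p s d x₀₀ x₀₁ x₁₀ x₁₁) (hp : 0 < p)
    [CompactSpace X] (μ : Measure X) [IsProbabilityMeasure μ]
    (hμ : ∀ᵐ y ∂μ, y ∈ ({x₀₀, x₀₁, x₁₀, x₁₁} : Set X)) :
    ∃ a b c e : ℝ, 0 ≤ a ∧ 0 ≤ b ∧ 0 ≤ c ∧ 0 ≤ e ∧ a + b + (c + e) = 1 ∧
      μ = fourDirac x₀₀ x₀₁ x₁₀ x₁₁ a b c e := by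
  classical
  obtain ⟨h1, h2, h3, h4, h5, h6⟩ := h.distinct hp
  have hsum : μ.real {x₀₀} + μ.real {x₀₁} + (μ.real {x₁₀} + μ.real {x₁₁}) = 1 := by
    have hS : (({x₀₀, x₀₁, x₁₀, x₁₁} : Finset X) : Set X) = {x₀₀, x₀₁, x₁₀, x₁₁} := by simp
    have h7 : μ {x₀₀, x₀₁, x₁₀, x₁₁} = 1 := (mem_ae_iff_prob_eq_one (Set.toFinite _).measurableSet).1 hμ
    have h8 := sum_measureReal_singleton (μ := μ) ({x₀₀, x₀₁, x₁₀, x₁₁} : Finset X)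
    rw [hS, measureReal_def, h7] at h8
    rw [Finset.sum_insert (by simp [h1, h2, h3]), Finset.sum_insert (by simp [h4, h5]),
      Finset.sum_insert (by simp [h6]), Finset.sum_singleton] at h8
    rw [← add_assoc] at h8
    rw [h8, ENNReal.toReal_one]
  refine ⟨_, _, _, _, measureReal_nonneg, measureReal_nonneg, measureReal_nonneg,
    measureReal_nonneg, hsum, ?_⟩
  have := isProbabilityMeasure_fourDirac x₀₀ x₀₁ x₁₀ x₁₁ (measureReal_nonneg (μ := μ))
    measureReal_nonneg measureReal_nonneg measureReal_nonneg hsum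
  refine measure_eq_of_singleton_eq (Set.toFinite _) hμ ?_
  rintro x (rfl | rfl | rfl | rfl) <;>
    simp [fourDirac, h1, h2, h3, h4, h5, h6, h1.symm, h2.symm, h3.symm, h4.symm, h5.symm, h6.symm]

/-- When the masses of two opposite sides agree, the excess can be moved along these sides alone. -/
theorem transportCost_le_sides (h : IsFarthestSquare p s d x₀₀ x₀₁ x₁₀ x₁₁) (hp : 0 < p)
    {a b c e a' b' c' e' : ℝ} (ha : 0 ≤ a) (hb : 0 ≤ b) (hc : 0 ≤ c) (he : 0 ≤ e) (ha' : 0 ≤ a')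
    (hb' : 0 ≤ b') (hc' : 0 ≤ c') (he' : 0 ≤ e') (hab : a + b = a' + b') (hce : c + e = c' + e') :
    transportCost p (fourDirac x₀₀ x₀₁ x₁₀ x₁₁ a b c e) (fourDirac x₀₀ x₀₁ x₁₀ x₁₁ a' b' c' e') ≤
      ENNReal.ofReal ((|a - a'| + |c - c'|) * s) := by
  refine (transportCost_add_le _ _ _ _).trans ?_
  refine (add_le_add (transportCost_pair_le hp _ _ ha hb ha' hb' hab)
    (transportCost_pair_le hp _ _ hc he hc' he' hce)).trans (le_of_eq ?_)
  rw [h.edist_left, h.edist_right, ← add_mul,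
    ← ENNReal.ofReal_add (abs_nonneg _) (abs_nonneg _), ← ENNReal.ofReal_mul (by positivity)]

/-- Mass gained by the pair `{x₀₁, x₁₀}` travels at least one side. This bound and its companion for
the other diagonal match `transportCost_le_sides` in the extremal cases. -/
theorem le_transportCost_antidiag (h : IsFarthestSquare p s d x₀₀ x₀₁ x₁₀ x₁₁) (hp : 0 < p)
    {a b c e a' b' c' e' : ℝ} (ha : 0 ≤ a) (hb : 0 ≤ b) (hc : 0 ≤ c) (he : 0 ≤ e)
    (hb' : 0 ≤ b') (hc' : 0 ≤ c') (hsum : a + b + (c + e) = 1) :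
    ENNReal.ofReal ((b' + c' - (b + c)) * s) ≤
      transportCost p (fourDirac x₀₀ x₀₁ x₁₀ x₁₁ a b c e)
        (fourDirac x₀₀ x₀₁ x₁₀ x₁₁ a' b' c' e') := by
  obtain ⟨h1, h2, h3, h4, h5, h6⟩ := h.distinct hp
  have := isProbabilityMeasure_fourDirac x₀₀ x₀₁ x₁₀ x₁₁ ha hb hc he hsum
  have hA : ∀ a b c e : ℝ, fourDirac x₀₀ x₀₁ x₁₀ x₁₁ a b c e {x₀₁, x₁₀} =
      ENNReal.ofReal b + ENNReal.ofReal c := fun a b c e => by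
    simp [fourDirac, h1, h2, h5.symm, h6.symm]
  refine le_trans (le_of_eq ?_) (mul_measure_sub_le_transportCost (ae_mem_fourDirac _ _ _ _ _ _ _ _)
    (ae_mem_fourDirac _ _ _ _ _ _ _ _) ((Set.toFinite {x₀₁, x₁₀}).measurableSet)
    h.side_le_edist)
  rw [hA, hA, ← ENNReal.ofReal_add hb hc, ← ENNReal.ofReal_add hb' hc',
    ← ENNReal.ofReal_sub _ (by positivity), ← ENNReal.ofReal_mul h.side_pos.le, mul_comm]

theorem le_transportCost_diag (h : IsFarthestSquare p s d x₀₀ x₀₁ x₁₀ x₁₁) (hp : 0 < p)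
    {a b c e a' b' c' e' : ℝ} (ha : 0 ≤ a) (hb : 0 ≤ b) (hc : 0 ≤ c) (he : 0 ≤ e)
    (ha' : 0 ≤ a') (he' : 0 ≤ e') (hsum : a + b + (c + e) = 1) :
    ENNReal.ofReal ((a' + e' - (a + e)) * s) ≤
      transportCost p (fourDirac x₀₀ x₀₁ x₁₀ x₁₁ a b c e)
        (fourDirac x₀₀ x₀₁ x₁₀ x₁₁ a' b' c' e') := by
  obtain ⟨h1, h2, h3, h4, h5, h6⟩ := h.distinct hp
  have := isProbabilityMeasure_fourDirac x₀₀ x₀₁ x₁₀ x₁₁ ha hb hc he hsum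
  have hA : ∀ a b c e : ℝ, fourDirac x₀₀ x₀₁ x₁₀ x₁₁ a b c e {x₀₀, x₁₁} =
      ENNReal.ofReal a + ENNReal.ofReal e := fun a b c e => by
    simp [fourDirac, h1.symm, h2.symm, h5, h6]
  refine le_trans (le_of_eq ?_) (mul_measure_sub_le_transportCost (ae_mem_fourDirac _ _ _ _ _ _ _ _)
    (ae_mem_fourDirac _ _ _ _ _ _ _ _) ((Set.toFinite {x₀₀, x₁₁}).measurableSet)
    h.side_le_edist)
  rw [hA, hA, ← ENNReal.ofReal_add ha he, ← ENNReal.ofReal_add ha' he',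
    ← ENNReal.ofReal_sub _ (by positivity), ← ENNReal.ofReal_mul h.side_pos.le, mul_comm]

end IsFarthestSquare

end Square

/-! ### Detecting the mass of a set by transport to two points -/

section TwoDirac

variable {X : Type*} [MetricSpace X] [MeasurableSpace X] [BorelSpace X]
  [SecondCountableTopology X] {p : ℝ}

/-- A combination of two Dirac masses, with weights `t` and `1 - t`. -/
noncomputable def twoDirac (x x' : X) (t : ℝ) : Measure X :=
  ENNReal.ofReal t • Measure.dirac x + ENNReal.ofReal (1 - t) • Measure.dirac x'

theorem twoDirac_symm (x x' : X) (t : ℝ) : twoDirac x x' t = twoDirac x' x (1 - t) := by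
  rw [twoDirac, twoDirac, sub_sub_cancel, add_comm]

theorem isProbabilityMeasure_twoDirac (x x' : X) {t : ℝ} (h0 : 0 ≤ t) (h1 : t ≤ 1) :
    IsProbabilityMeasure (twoDirac x x' t) := by
  constructor
  simp only [twoDirac, Measure.add_apply, Measure.smul_apply, measure_univ, smul_eq_mul, mul_one]
  rw [← ENNReal.ofReal_add h0 (by linarith), add_sub_cancel, ENNReal.ofReal_one]

theorem ae_mem_twoDirac (x x' : X) (t : ℝ) : ∀ᵐ y ∂(twoDirac x x' t), y = x ∨ y = x' := by
  have hm : MeasurableSet {y : X | y = x ∨ y = x'} := (Set.toFinite {x, x'}).measurableSet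
  have key : ∀ z, z = x ∨ z = x' → ∀ t : ℝ≥0∞,
      ∀ᵐ y ∂(t • Measure.dirac z), y = x ∨ y = x' := fun z hz t =>
    Measure.ae_smul_measure ((ae_dirac_iff hm).2 hz) t
  simp only [twoDirac, ae_add_measure_iff]
  exact ⟨key _ (by simp) _, key _ (by simp) _⟩

theorem twoDirac_apply_of_mem_of_notMem {x x' : X} (t : ℝ) {A : Set X} (hA : MeasurableSet A)
    (hx : x ∈ A) (hx' : x' ∉ A) : twoDirac x x' t A = ENNReal.ofReal t := by
  simp [twoDirac, Measure.dirac_apply' _ hA, hx, hx']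

variable [CompactSpace X]

/-- Relative to sending everything to `x'`, mass sent to `x` saves at most `M` per unit, and
strictly less from outside `A`. A total saving of `t M` thus needs mass `t` inside `A`. Optimal
couplings are not used, so the strict loss is made quantitative. -/
theorem le_measure_of_transportCost_le (hp : 0 < p) {μ : Measure X} [IsProbabilityMeasure μ]
    {x x' : X} (hx : x ≠ x') {A : Set X} {M : ℝ≥0∞} (hM : M ≠ ∞)
    (hle : ∀ y, edist y x' ^ p ≤ edist y x ^ p + M)
    (hA : ∀ y, edist y x' ^ p = edist y x ^ p + M → y ∈ A) {t : ℝ}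
    (h : transportCost p μ (twoDirac x x' t) + ENNReal.ofReal t * M ≤
      ∫⁻ y, edist y x' ^ p ∂μ) : ENNReal.ofReal t ≤ μ A := by
  by_contra! hlt
  have hT := lintegral_edist_rpow_ne_top hp.le μ x'
  have hmx := measurable_edist_rpow_left (p := p) x
  have hmx' := measurable_edist_rpow_left (p := p) x'
  set δ : ℕ → ℝ≥0∞ := fun n => (n + 1 : ℝ≥0∞)⁻¹ with hδ
  have hδ0 : ∀ n, 0 < δ n := fun n => ENNReal.inv_pos.2 (by simp)
  -- Points whose saving is within `δ n` of the maximum. These sets decrease into `A`, so some `B n`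
  -- still has mass below `t`.
  set B : ℕ → Set X := fun n => {y | edist y x ^ p + M < edist y x' ^ p + δ n} with hB
  have hBm : ∀ n, MeasurableSet (B n) := fun n =>
    measurableSet_lt (hmx.add_const _) (hmx'.add_const _)
  have hanti : Antitone B := fun m n hmn y hy => by
    refine lt_of_lt_of_le (Set.mem_ofPred.1 hy) ?_
    have : δ n ≤ δ m := ENNReal.inv_le_inv.2 (by gcongr)
    gcongr
  have hinter : ⋂ n, B n ⊆ A := fun y hy => by
    refine hA y (le_antisymm (hle y) ?_)
    refine ENNReal.le_of_forall_pos_le_add fun ε hε _ => ?_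
    obtain ⟨n, hn⟩ := ENNReal.exists_inv_nat_lt (a := (ε : ℝ≥0∞)) (by simpa using hε.ne')
    have h1 := Set.mem_iInter.1 hy n
    refine (Set.mem_ofPred.1 h1).le.trans ?_
    have : δ n ≤ (n : ℝ≥0∞)⁻¹ := ENNReal.inv_le_inv.2 le_self_add
    gcongr
    exact this.trans hn.le
  obtain ⟨n, hn⟩ : ∃ n, μ (B n) < ENNReal.ofReal t := by
    have h1 := tendsto_measure_iInter_atTop (μ := μ) (fun n => (hBm n).nullMeasurableSet) hanti
      ⟨0, measure_ne_top _ _⟩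
    exact (h1.eventually_lt_const ((measure_mono hinter).trans_lt hlt)).exists
  -- At least `t - μ (B n)` of the mass sent to `x` starts outside `B n`, and each unit of it falls
  -- short of the maximal saving by at least `δ n`.
  set η := δ n * (ENNReal.ofReal t - μ (B n)) with hη
  have hη0 : η ≠ 0 := mul_ne_zero (hδ0 n).ne' (tsub_pos_of_lt hn).ne'
  have hC : transportCost p μ (twoDirac x x' t) ≠ ∞ := ne_top_of_le_ne_top hT (le_self_add.trans h)
  obtain ⟨π, hπ, hlt'⟩ := exists_coupling_lt (ENNReal.lt_add_right hC hη0)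
  have hsx : MeasurableSet (Prod.snd ⁻¹' {x} : Set (X × X)) :=
    measurable_snd (measurableSet_singleton x)
  set S : Set (X × X) := Prod.snd ⁻¹' {x} \ Prod.fst ⁻¹' (B n) with hS
  have hSm : MeasurableSet S := hsx.diff (measurable_fst (hBm n))
  have hπx : π (Prod.snd ⁻¹' {x}) = ENNReal.ofReal t := by
    rw [hπ.measure_snd (measurableSet_singleton x)]
    exact twoDirac_apply_of_mem_of_notMem t (measurableSet_singleton x) rfl fun h => hx h.symm
  have hπS : ENNReal.ofReal t - μ (B n) ≤ π S := by
    rw [← hπx, ← hπ.measure_fst (hBm n)]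
    exact le_measure_sdiff
  have hmz : Measurable fun z : X × X => edist z.1 x' ^ p := hmx'.comp measurable_fst
  have hTπ : ∫⁻ y, edist y x' ^ p ∂μ = ∫⁻ z, edist z.1 x' ^ p ∂π := by
    rw [← hπ.1, lintegral_map hmx' measurable_fst]
  have key : ∫⁻ y, edist y x' ^ p ∂μ + η ≤
      ∫⁻ z, edist z.1 z.2 ^ p ∂π + ENNReal.ofReal t * M := by
    calc ∫⁻ y, edist y x' ^ p ∂μ + η
        ≤ ∫⁻ z, edist z.1 x' ^ p ∂π + δ n * π S := by
          rw [hTπ, hη]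
          gcongr
      _ = ∫⁻ z, (edist z.1 x' ^ p + S.indicator (fun _ => δ n) z) ∂π := by
          rw [lintegral_add_left hmz, lintegral_indicator_const hSm]
      _ ≤ ∫⁻ z, (edist z.1 z.2 ^ p + (Prod.snd ⁻¹' {x}).indicator (fun _ => M) z) ∂π := by
          refine lintegral_mono_ae ?_
          filter_upwards [hπ.ae_snd (ae_mem_twoDirac x x' t)] with z hz
          rcases hz with hz | hz
          · rw [Set.indicator_of_mem (show z ∈ Prod.snd ⁻¹' {x} from hz), hz]
            by_cases hzS : z ∈ S
            · rw [Set.indicator_of_mem hzS]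
              exact not_lt.1 hzS.2
            · rw [Set.indicator_of_notMem hzS, add_zero]
              exact hle _
          · have h1 : z ∉ Prod.snd ⁻¹' {x} := fun h => hx ((show z.2 = x from h).symm.trans hz)
            rw [Set.indicator_of_notMem h1, Set.indicator_of_notMem fun h => h1 h.1, hz]
      _ = _ := by
          rw [lintegral_add_left measurable_edist_rpow, lintegral_indicator_const hsx, hπx,
            mul_comm]
  have hfin' : ENNReal.ofReal t * M ≠ ∞ := ENNReal.mul_ne_top ENNReal.ofReal_ne_top hM
  have := calc ∫⁻ y, edist y x' ^ p ∂μ + η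
        ≤ ∫⁻ z, edist z.1 z.2 ^ p ∂π + ENNReal.ofReal t * M := key
      _ < transportCost p μ (twoDirac x x' t) + η + ENNReal.ofReal t * M :=
          ENNReal.add_lt_add_right hfin' hlt'
      _ = transportCost p μ (twoDirac x x' t) + ENNReal.ofReal t * M + η := by ring
      _ ≤ ∫⁻ y, edist y x' ^ p ∂μ + η := by gcongr
  exact lt_irrefl _ this

/-- If `A` has enough mass, the maximal saving is attained: send the fraction `t / μ(A)` of the mass
of `A` to `x` and everything else to `x'`. -/
theorem transportCost_le_of_le_measure {μ : Measure X} [IsProbabilityMeasure μ]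
    {x x' : X} {A : Set X} {M : ℝ≥0∞} (hAm : MeasurableSet A)
    (hA : ∀ y ∈ A, edist y x' ^ p = edist y x ^ p + M) {t : ℝ} (ht0 : 0 < t)
    (h : ENNReal.ofReal t ≤ μ A) :
    transportCost p μ (twoDirac x x' t) + ENNReal.ofReal t * M ≤ ∫⁻ y, edist y x' ^ p ∂μ := by
  have hA0 : μ A ≠ 0 := fun h0 => by
    rw [h0, nonpos_iff_eq_zero, ENNReal.ofReal_eq_zero] at h
    linarith
  set c := ENNReal.ofReal t / μ A with hc
  have hc1 : c ≤ 1 := ENNReal.div_le_of_le_mul (by rwa [one_mul])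
  set α := c • μ.restrict A with hα
  set β := (1 - c) • μ.restrict A + μ.restrict Aᶜ with hβ
  have hαβ : α + β = μ := by
    rw [hα, hβ, ← add_assoc, ← add_smul, add_tsub_cancel_of_le hc1, one_smul,
      Measure.restrict_add_restrict_compl hAm]
  have hαu : α Set.univ = ENNReal.ofReal t := by
    simp [hα, hc, ENNReal.div_mul_cancel hA0 (measure_ne_top _ _)]
  have hβu : β Set.univ = ENNReal.ofReal (1 - t) := by
    have h1 : α Set.univ + β Set.univ = 1 := by
      rw [← Measure.add_apply, hαβ, measure_univ]
    rw [hαu] at h1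
    rw [ENNReal.ofReal_sub _ ht0.le, ENNReal.ofReal_one]
    exact ENNReal.eq_sub_of_add_eq ENNReal.ofReal_ne_top (by rwa [add_comm])
  have hle : transportCost p μ (twoDirac x x' t) ≤
      ∫⁻ y, edist y x ^ p ∂α + ∫⁻ y, edist y x' ^ p ∂β := by
    have h1 := (transportCost_add_le (p := p) α (α Set.univ • Measure.dirac x) β
      (β Set.univ • Measure.dirac x')).trans
      (add_le_add (transportCost_smul_dirac_right_le α x)
        (transportCost_smul_dirac_right_le β x'))
    rwa [hαβ, hαu, hβu] at h1
  calc _ ≤ ∫⁻ y, edist y x ^ p ∂α + ∫⁻ y, edist y x' ^ p ∂β + ENNReal.ofReal t * M := by gcongr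
    _ = ∫⁻ y, (edist y x ^ p + M) ∂α + ∫⁻ y, edist y x' ^ p ∂β := by
        rw [lintegral_add_left (measurable_edist_rpow_left x), lintegral_const, hαu]
        ring
    _ = ∫⁻ y, edist y x' ^ p ∂α + ∫⁻ y, edist y x' ^ p ∂β := by
        congr 1
        refine lintegral_congr_ae (Measure.ae_smul_measure ?_ c)
        filter_upwards [ae_restrict_mem hAm] with y hy
        exact (hA y hy).symm
    _ = ∫⁻ y, edist y x' ^ p ∂μ := by rw [← lintegral_add_measure, hαβ]

end TwoDirac

/-! ### Isometries that fix all Dirac masses -/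

namespace WassersteinSpace

variable {X : Type*} [MetricSpace X] [MeasurableSpace X] [BorelSpace X]
  [SecondCountableTopology X] [CompactSpace X] {p : ℝ}

instance (μ : WassersteinSpace p X) : IsProbabilityMeasure μ.toMeasure := μ.1.2

/-- Over a compact space, every Borel probability measure is a point of the Wasserstein space. -/
def ofMeasure (hp : 0 ≤ p) (μ : Measure X) [h : IsProbabilityMeasure μ] : WassersteinSpace p X :=
  ⟨⟨μ, h⟩, fun x => (lintegral_edist_rpow_ne_top hp μ x).lt_top⟩

theorem toMeasure_ofMeasure (hp : 0 ≤ p) (μ : Measure X) [IsProbabilityMeasure μ] :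
    (ofMeasure hp μ).toMeasure = μ := rfl

theorem dist_eq_dist_iff (hp : 0 < p) {μ ν μ' ν' : WassersteinSpace p X} :
    dist μ ν = dist μ' ν' ↔
      transportCost p μ.toMeasure ν.toMeasure = transportCost p μ'.toMeasure ν'.toMeasure := by
  have h : ∀ μ ν : WassersteinSpace p X,
      transportCost p μ.toMeasure ν.toMeasure ^ (1 / p) ≠ ∞ := fun μ ν =>
    ENNReal.rpow_ne_top_of_nonneg (by positivity) (transportCost_ne_top hp.le _ _)
  rw [dist_def, dist_def, ENNReal.toReal_eq_toReal_iff' (h _ _) (h _ _)]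
  exact (ENNReal.rpow_left_injective (one_div_pos.2 hp).ne').eq_iff

/-- The bijections of the Wasserstein space that preserve the transport cost and fix each Dirac
mass. -/
structure IsDiracFixing (F : Equiv.Perm (WassersteinSpace p X)) : Prop where
  cost_eq : ∀ μ ν, transportCost p (F μ).toMeasure (F ν).toMeasure =
    transportCost p μ.toMeasure ν.toMeasure
  map_dirac : ∀ μ x, μ.toMeasure = Measure.dirac x → F μ = μ

/-- A measure is fixed by `F` if the corresponding point of the Wasserstein space is. -/
def Fixes (F : Equiv.Perm (WassersteinSpace p X)) (κ : Measure X) : Prop :=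
  ∀ μ : WassersteinSpace p X, μ.toMeasure = κ → F μ = μ

namespace IsDiracFixing

variable {F : Equiv.Perm (WassersteinSpace p X)}

theorem symm (hF : IsDiracFixing F) : IsDiracFixing F.symm where
  cost_eq μ ν := by
    have h := hF.cost_eq (F.symm μ) (F.symm ν)
    rw [F.apply_symm_apply, F.apply_symm_apply] at h
    exact h.symm
  map_dirac μ x h := by
    rw [Equiv.symm_apply_eq]
    exact (hF.map_dirac μ x h).symm

/-- The only coupling with a Dirac mass is the product, so the potential at `x` is the cost of
transport to a fixed point of `F`. -/
theorem lintegral_edist (hF : IsDiracFixing F) (hp : 0 < p) (μ : WassersteinSpace p X) (x : X) :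
    ∫⁻ y, edist y x ^ p ∂(F μ).toMeasure = ∫⁻ y, edist y x ^ p ∂μ.toMeasure := by
  have h := hF.cost_eq μ (ofMeasure hp.le (Measure.dirac x))
  rw [hF.map_dirac (ofMeasure hp.le (Measure.dirac x)) x rfl, toMeasure_ofMeasure] at h
  rwa [transportCost_dirac_right, transportCost_dirac_right] at h

/-- The condition `t ≤ μ(A)` is expressed through the cost to a fixed two-point measure and a
potential, both preserved by `F`. Excluding `t = 1/2` is harmless because the remaining `t` are
dense in the unit interval. -/
theorem measure_le (hF : IsDiracFixing F) (hp : 0 < p) {x x' : X} (hx : x ≠ x') {A : Set X}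
    (hAm : MeasurableSet A) {M : ℝ≥0∞} (hM : M ≠ ∞)
    (hle : ∀ y, edist y x' ^ p ≤ edist y x ^ p + M)
    (hA : ∀ y, edist y x' ^ p = edist y x ^ p + M ↔ y ∈ A)
    (hfix : ∀ t : ℝ, 0 < t → t < 1 → t ≠ 1 / 2 → Fixes F (twoDirac x x' t))
    (μ : WassersteinSpace p X) : μ.toMeasure A ≤ (F μ).toMeasure A := by
  by_contra! hlt
  have hstep : ∀ t : ℝ, 0 < t → t < 1 → t ≠ 1 / 2 → ENNReal.ofReal t ≤ μ.toMeasure A →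
      ENNReal.ofReal t ≤ (F μ).toMeasure A := fun t h0 h1 h2 h => by
    have h3 := transportCost_le_of_le_measure hAm (fun y hy => (hA y).2 hy) h0 h
    refine le_measure_of_transportCost_le hp hx hM hle (fun y => (hA y).1) ?_
    have := isProbabilityMeasure_twoDirac x x' h0.le h1.le
    have h4 := hF.cost_eq μ (ofMeasure hp.le (twoDirac x x' t))
    rw [hfix t h0 h1 h2 _ (toMeasure_ofMeasure _ _), toMeasure_ofMeasure] at h4
    rwa [h4, hF.lintegral_edist hp]
  set a := ((F μ).toMeasure A).toReal
  set b := (μ.toMeasure A).toReal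
  have hab : a < b := (ENNReal.toReal_lt_toReal (measure_ne_top _ _) (measure_ne_top _ _)).2 hlt
  have ha : 0 ≤ a := ENNReal.toReal_nonneg
  have hb : b ≤ 1 := ENNReal.toReal_le_of_le_ofReal zero_le_one (by simpa using prob_le_one)
  obtain ⟨t, h1, h2, h3⟩ : ∃ t, a < t ∧ t < b ∧ t ≠ 1 / 2 := by
    by_cases h : (a + b) / 2 = 1 / 2
    · exact ⟨(a + (a + b) / 2) / 2, by linarith, by linarith, by intro h'; linarith⟩
    · exact ⟨(a + b) / 2, by linarith, by linarith, h⟩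
  have h4 := hstep t (by linarith) (by linarith) h3
    (ENNReal.ofReal_le_of_le_toReal h2.le)
  have h5 := (ENNReal.ofReal_le_iff_le_toReal (measure_ne_top _ _)).1 h4
  linarith

theorem measure_eq (hF : IsDiracFixing F) (hp : 0 < p) {x x' : X} (hx : x ≠ x') {A : Set X}
    (hAm : MeasurableSet A) {M : ℝ≥0∞} (hM : M ≠ ∞)
    (hle : ∀ y, edist y x' ^ p ≤ edist y x ^ p + M)
    (hA : ∀ y, edist y x' ^ p = edist y x ^ p + M ↔ y ∈ A)
    (hfix : ∀ t : ℝ, 0 < t → t < 1 → t ≠ 1 / 2 → Fixes F (twoDirac x x' t))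
    (μ : WassersteinSpace p X) : (F μ).toMeasure A = μ.toMeasure A := by
  refine le_antisymm ?_ (hF.measure_le hp hx hAm hM hle hA hfix μ)
  have h := hF.symm.measure_le hp hx hAm hM hle hA (fun t h0 h1 h2 ν hν => by
    rw [Equiv.symm_apply_eq]; exact (hfix t h0 h1 h2 ν hν).symm) (F μ)
  rwa [F.symm_apply_apply] at h

/-- Finitely supported measures are fixed, and any `μ` is as far from them as `F μ` is; density then
gives `F μ = μ`. -/
theorem eq_one_of_measure_singleton (hF : IsDiracFixing F) (hp : 0 < p)
    (h : ∀ μ x, (F μ).toMeasure {x} = μ.toMeasure {x}) : F = 1 := by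
  have hfin : ∀ μ : WassersteinSpace p X, ∀ S : Set X, S.Finite →
      (∀ᵐ x ∂μ.toMeasure, x ∈ S) → F μ = μ := fun μ S hS hμ =>
    toMeasure_injective (measure_eq_of_singleton_eq hS hμ fun x _ => (h μ x).symm).symm
  refine Equiv.ext fun μ => toMeasure_injective ?_
  refine eq_of_transportCost_le hp fun ε h0 h1 => ?_
  obtain ⟨q, hq⟩ := exists_simpleFunc_transportCost_map_le hp μ.toMeasure h0 h1
  have hprob : IsProbabilityMeasure (μ.toMeasure.map q) :=
    Measure.isProbabilityMeasure_map q.measurable.aemeasurable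
  refine ⟨μ.toMeasure.map q, hprob, ?_, hq⟩
  have h2 := hF.cost_eq μ (ofMeasure hp.le (μ.toMeasure.map q))
  rw [hfin (ofMeasure hp.le (μ.toMeasure.map q)) (Set.range q) q.finite_range
    ((ae_map_iff q.measurable.aemeasurable q.finite_range.measurableSet).2
      (.of_forall fun x => ⟨x, rfl⟩)), toMeasure_ofMeasure] at h2
  exact h2.trans_le hq

variable {s d : ℝ} {x₀₀ x₀₁ x₁₀ x₁₁ : X}

/-- A sum of four potentials attains its upper bound `K` only for measures carried by the square,
and `F` preserves this sum. -/
theorem ae_mem_square (hF : IsDiracFixing F) (hp : 0 < p)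
    (hQ : IsFarthestSquare p s d x₀₀ x₀₁ x₁₀ x₁₁) {μ : WassersteinSpace p X}
    (hμ : ∀ᵐ y ∂μ.toMeasure, y ∈ ({x₀₀, x₀₁, x₁₀, x₁₁} : Set X)) :
    ∀ᵐ y ∂(F μ).toMeasure, y ∈ ({x₀₀, x₀₁, x₁₀, x₁₁} : Set X) := by
  obtain ⟨v, K, hK, hle, heq⟩ := hQ.exists_farthest
  have hm : ∀ i, Measurable fun y => edist y (v i) ^ p := fun i => measurable_edist_rpow_left _
  have h1 : ∫⁻ y, ∑ i, edist y (v i) ^ p ∂(F μ).toMeasure = K := by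
    rw [lintegral_finsetSum _ fun i _ => hm i]
    simp only [hF.lintegral_edist hp]
    rw [← lintegral_finsetSum _ fun i _ => hm i]
    have : ∫⁻ y, ∑ i, edist y (v i) ^ p ∂μ.toMeasure = ∫⁻ _, K ∂μ.toMeasure := by
      refine lintegral_congr_ae ?_
      filter_upwards [hμ] with y hy
      exact (heq y).2 hy
    rw [this]
    simp
  have h2 := ae_eq_of_ae_le_of_lintegral_le (μ := (F μ).toMeasure)
    (f := fun y => ∑ i, edist y (v i) ^ p) (g := fun _ => K) (.of_forall hle) (by rwa [h1])
    aemeasurable_const (by rw [h1]; simp)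
  filter_upwards [h2] with y hy
  exact (heq y).1 hy

theorem exists_map_fourDirac (hF : IsDiracFixing F) (hp : 0 < p)
    (hQ : IsFarthestSquare p s d x₀₀ x₀₁ x₁₀ x₁₁) {μ : WassersteinSpace p X} {a b c e : ℝ}
    (ha : 0 ≤ a) (hb : 0 ≤ b) (hc : 0 ≤ c) (he : 0 ≤ e) (hsum : a + b + (c + e) = 1)
    (hμ : μ.toMeasure = fourDirac x₀₀ x₀₁ x₁₀ x₁₁ a b c e) :
    ∃ a' b' c' e' : ℝ, 0 ≤ a' ∧ 0 ≤ b' ∧ 0 ≤ c' ∧ 0 ≤ e' ∧ a' + b' + (c' + e') = 1 ∧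
      a' + b' = a + b ∧ a' + c' = a + c ∧
      (F μ).toMeasure = fourDirac x₀₀ x₀₁ x₁₀ x₁₁ a' b' c' e' := by
  obtain ⟨a', b', c', e', ha', hb', hc', he', hsum', hμ'⟩ := hQ.exists_eq_fourDirac hp
    (F μ).toMeasure (hF.ae_mem_square hp hQ (by rw [hμ]; exact ae_mem_fourDirac _ _ _ _ _ _ _ _))
  refine ⟨a', b', c', e', ha', hb', hc', he', hsum', ?_, ?_, hμ'⟩
  all_goals
    have hs := hQ.side_pos.le
    have hd := hQ.diag_pos
    have hpot := fun x => hF.lintegral_edist hp μ x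
    simp only [hμ, hμ', lintegral_fourDirac] at hpot
    have h00 := hpot x₀₀
    have h01 := hpot x₀₁
    have h10 := hpot x₁₀
    have h11 := hpot x₁₁
    simp only [edist_self, ENNReal.zero_rpow_of_pos hp, mul_zero, zero_add, add_zero,
      hQ.edist_left, hQ.edist_right, hQ.edist_bot, hQ.edist_top, hQ.edist_diag, hQ.edist_diag',
      edist_comm x₀₁ x₀₀, edist_comm x₁₀ x₀₀, edist_comm x₁₁ x₀₀, edist_comm x₁₀ x₀₁,
      edist_comm x₁₁ x₀₁, edist_comm x₁₁ x₁₀] at h00 h01 h10 h11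
    simp only [← ENNReal.ofReal_mul, ha, hb, hc, he, ha', hb', hc', he'] at h00 h01 h10 h11
    rw [← ENNReal.ofReal_add (by positivity) (by positivity),
      ← ENNReal.ofReal_add (by positivity) (by positivity),
      ← ENNReal.ofReal_add (by positivity) (by positivity),
      ← ENNReal.ofReal_add (by positivity) (by positivity),
      ENNReal.ofReal_eq_ofReal_iff (by positivity) (by positivity)] at h00 h01 h10 h11
    -- Adding the potentials at the ends of one side and subtracting those of the opposite side
    -- cancels all terms in `s`. What remains is `d` times a difference of opposite side masses; the
    -- total mass turns it into `2 d` times one of them.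
    refine mul_left_cancel₀ (mul_pos two_pos hd).ne' ?_
  · linear_combination -(h00 + h01 - h10 - h11) + d * (hsum' - hsum)
  · linear_combination -(h00 + h10 - h01 - h11) + d * (hsum' - hsum)

/-- The marginals `(t, 1 - t)` and `(1/2, 1/2)` determine a segment of measures on the square. Its
midpoint `ω` must be fixed, and the distance to `ω` then identifies the diagonal measure among the
measures with its own marginals. -/
theorem fixes_diag_of_lt (hF : IsDiracFixing F) (hp : 0 < p)
    (hQ : IsFarthestSquare p s d x₀₀ x₀₁ x₁₀ x₁₁) {t : ℝ} (h0 : 0 < t) (h1 : t < 1 / 2) :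
    Fixes F (twoDirac x₀₀ x₁₁ t) := by
  have hs := hQ.side_pos
  have hω : IsProbabilityMeasure
      (fourDirac x₀₀ x₀₁ x₁₀ x₁₁ (t / 2) (t / 2) ((1 - t) / 2) ((1 - t) / 2)) :=
    isProbabilityMeasure_fourDirac _ _ _ _ (by linarith) (by linarith) (by linarith) (by linarith)
      (by ring)
  set ω : WassersteinSpace p X := ofMeasure hp.le
      (fourDirac x₀₀ x₀₁ x₁₀ x₁₁ (t / 2) (t / 2) ((1 - t) / 2) ((1 - t) / 2)) with hωdef
  have hωm : ω.toMeasure =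
      fourDirac x₀₀ x₀₁ x₁₀ x₁₁ (t / 2) (t / 2) ((1 - t) / 2) ((1 - t) / 2) := rfl
  -- every measure with the same marginals as `ω` is close to `F ω`
  have hball : ∀ a b c e : ℝ, 0 ≤ a → 0 ≤ b → 0 ≤ c → 0 ≤ e → a + b + (c + e) = 1 → a + b = t →
      a + c = 1 / 2 → transportCost p (F ω).toMeasure (fourDirac x₀₀ x₀₁ x₁₀ x₁₁ a b c e) ≤
        ENNReal.ofReal (t * s) := by
    intro a b c e ha hb hc he hsum hab hac
    have hprob := isProbabilityMeasure_fourDirac x₀₀ x₀₁ x₁₀ x₁₁ ha hb hc he hsum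
    set μ : WassersteinSpace p X := ofMeasure hp.le (fourDirac x₀₀ x₀₁ x₁₀ x₁₁ a b c e)
    obtain ⟨a', b', c', e', ha', hb', hc', he', hsum', hab', hac', hμ'⟩ :=
      hF.symm.exists_map_fourDirac hp hQ (μ := μ) ha hb hc he hsum rfl
    have h2 := hF.cost_eq ω (F.symm μ)
    rw [F.apply_symm_apply, hμ', hωm] at h2
    rw [show fourDirac x₀₀ x₀₁ x₁₀ x₁₁ a b c e = μ.toMeasure from rfl, h2]
    refine (hQ.transportCost_le_sides hp (by linarith) (by linarith) (by linarith) (by linarith)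
      ha' hb' hc' he' (by linarith) (by linarith)).trans (ENNReal.ofReal_le_ofReal ?_)
    refine mul_le_mul_of_nonneg_right ?_ hs.le
    have h3 : |t / 2 - a'| ≤ t / 2 := abs_le.2 ⟨by linarith, by linarith⟩
    have h4 : |(1 - t) / 2 - c'| ≤ t / 2 := abs_le.2 ⟨by linarith, by linarith⟩
    linarith
  -- The two ends of the segment give mass `t + 1/2` to one diagonal pair each. As `F ω` is within
  -- cost `t s` of both, each diagonal pair has `F ω`-mass at least `1/2`, hence exactly `1/2`.
  have hFω : (F ω).toMeasure = ω.toMeasure := by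
    obtain ⟨a, b, c, e, ha, hb, hc, he, hsum, hab, hac, hμ⟩ :=
      hF.exists_map_fourDirac hp hQ (μ := ω) (by linarith) (by linarith) (by linarith)
        (by linarith) (by ring) hωm
    have h2 := (hQ.le_transportCost_antidiag hp ha hb hc he (a' := 0) (b' := t) (c' := 1 / 2)
      (e' := 1 / 2 - t) h0.le (by norm_num) hsum).trans (hμ ▸ hball 0 t (1 / 2) (1 / 2 - t) le_rfl
        h0.le (by norm_num) (by linarith) (by ring) (by ring) (by ring))
    have h3 := (hQ.le_transportCost_diag hp ha hb hc he (a' := t) (b' := 0) (c' := 1 / 2 - t)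
      (e' := 1 / 2) h0.le (by norm_num) hsum).trans (hμ ▸ hball t 0 (1 / 2 - t) (1 / 2) h0.le
        le_rfl (by linarith) (by norm_num) (by ring) (by ring) (by ring))
    have h2 := le_of_mul_le_mul_right ((ENNReal.ofReal_le_ofReal_iff (by positivity)).1 h2) hs
    have h3 := le_of_mul_le_mul_right ((ENNReal.ofReal_le_ofReal_iff (by positivity)).1 h3) hs
    rw [hμ, hωm]
    congr 1 <;> linarith
  intro μ hμ
  have hμ4 : μ.toMeasure = fourDirac x₀₀ x₀₁ x₁₀ x₁₁ t 0 0 (1 - t) := by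
    rw [hμ, twoDirac, fourDirac]
    simp
  obtain ⟨a, b, c, e, ha, hb, hc, he, hsum, hab, hac, hμ'⟩ :=
    hF.exists_map_fourDirac hp hQ (μ := μ) h0.le le_rfl le_rfl (by linarith) (by ring) hμ4
  have h2 := hF.cost_eq μ ω
  rw [hFω, hμ', hμ4, hωm] at h2
  have h3 := (hQ.le_transportCost_antidiag hp h0.le le_rfl le_rfl (by linarith)
    (a' := t / 2) (b' := t / 2) (c' := (1 - t) / 2) (e' := (1 - t) / 2) (by linarith)
    (by linarith) (by ring)).trans (h2.symm.le.trans (hQ.transportCost_le_sides hp ha hb hc he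
      (by linarith) (by linarith) (by linarith) (by linarith) (by linarith) (by linarith)))
  have h3 := le_of_mul_le_mul_right ((ENNReal.ofReal_le_ofReal_iff (by positivity)).1 h3) hs
  -- The marginals give `b = c ≤ t < 1 - t`, so for `b > 0` the cost from `F μ` to `ω` would be
  -- below `s / 2`, the lower bound just obtained from `μ`. For `t = 1/2` the opposite diagonal
  -- measure `b = c = 1/2` would escape this argument.
  have hb0 : b = 0 := by
    by_contra hb0
    have hb0 : 0 < b := lt_of_le_of_ne hb (Ne.symm hb0)
    have h4 : |a - t / 2| ≤ t / 2 := abs_le.2 ⟨by linarith, by linarith⟩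
    have h5 : |c - (1 - t) / 2| < (1 - t) / 2 := abs_lt.2 ⟨by linarith, by linarith⟩
    linarith
  refine toMeasure_injective ?_
  rw [hμ', hμ4]
  congr 1 <;> linarith

theorem fixes_diag (hF : IsDiracFixing F) (hp : 0 < p)
    (hQ : IsFarthestSquare p s d x₀₀ x₀₁ x₁₀ x₁₁) {t : ℝ} (h0 : 0 < t) (h1 : t < 1)
    (h2 : t ≠ 1 / 2) : Fixes F (twoDirac x₀₀ x₁₁ t) := by
  rcases lt_or_gt_of_ne h2 with h | h
  · exact hF.fixes_diag_of_lt hp hQ h0 h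
  · rw [twoDirac_symm]
    exact hF.fixes_diag_of_lt hp hQ.flip (by linarith) (by linarith)

end IsDiracFixing
end WassersteinSpace

/-! ### Inequalities for real powers -/

section RealInequalities

/-- The function `a ↦ √(a² + c)` lies below its chord on `[0, 1/2]`, and the power `2 q ≥ 1` is
convex and increasing. Strictness needs `c > 0`: for `c = 0` and `q = 1/2` the function is linear.
-/
theorem Real.add_sq_rpow_le {q a c : ℝ} (hq : 1 / 2 ≤ q) (ha : 0 ≤ a) (ha' : a ≤ 1 / 2)
    (hc : 0 ≤ c) :
    (a ^ 2 + c) ^ q ≤ (1 - 2 * a) * c ^ q + 2 * a * (1 / 4 + c) ^ q ∧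
      (0 < a → a < 1 / 2 → 0 < c →
        (a ^ 2 + c) ^ q < (1 - 2 * a) * c ^ q + 2 * a * (1 / 4 + c) ^ q) := by
  set u := √c with hu
  set v := √(1 / 4 + c) with hv
  have hu0 : 0 ≤ u := Real.sqrt_nonneg _
  have hv0 : 0 ≤ v := Real.sqrt_nonneg _
  have hu2 : u ^ 2 = c := Real.sq_sqrt hc
  have hv2 : v ^ 2 = 1 / 4 + c := Real.sq_sqrt (by linarith)
  have huv : u < v := Real.sqrt_lt_sqrt hc (by linarith)
  have hpow : ∀ w : ℝ, 0 ≤ w → (w ^ 2) ^ q = w ^ (2 * q) := fun w hw => by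
    rw [Real.rpow_mul hw, Real.rpow_two]
  -- The chord of `√(a² + c)` between its values `u` at `0` and `v` at `1/2`.
  set w := (1 - 2 * a) * u + 2 * a * v with hw
  have hw0 : 0 ≤ w := add_nonneg (mul_nonneg (by linarith) hu0) (by positivity)
  have hconv : w ^ (2 * q) ≤ (1 - 2 * a) * c ^ q + 2 * a * (1 / 4 + c) ^ q := by
    have h := (convexOn_rpow (p := 2 * q) (by linarith)).2 hu0 hv0
      (show (0 : ℝ) ≤ 1 - 2 * a by linarith) (show (0 : ℝ) ≤ 2 * a by linarith) (by ring)
    simp only [smul_eq_mul] at h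
    rwa [← hpow u hu0, ← hpow v hv0, hu2, hv2] at h
  have hw2 : w ^ 2 = a ^ 2 + c + 4 * a * (1 - 2 * a) * u * (v - u) := by
    have : w ^ 2 = (1 - 2 * a) ^ 2 * u ^ 2 + 4 * a ^ 2 * v ^ 2 + 4 * a * (1 - 2 * a) * (u * v) := by
      rw [hw]; ring
    rw [this, hv2, ← hu2]
    ring
  constructor
  · refine le_trans ?_ hconv
    rw [← hpow w hw0]
    refine Real.rpow_le_rpow (by positivity) ?_ (by linarith)
    have : 0 ≤ 4 * a * (1 - 2 * a) * u * (v - u) :=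
      mul_nonneg (mul_nonneg (mul_nonneg (by linarith) (by linarith)) hu0) (by linarith)
    linarith
  · intro h1 h2 h3
    refine lt_of_lt_of_le ?_ hconv
    rw [← hpow w hw0]
    refine Real.rpow_lt_rpow (by positivity) ?_ (by linarith)
    have : 0 < 4 * a * (1 - 2 * a) * u * (v - u) :=
      mul_pos (mul_pos (mul_pos (by linarith) (by linarith)) (Real.sqrt_pos.2 h3)) (by linarith)
    linarith

theorem Real.add_sq_rpow_add_le {q a c : ℝ} (hq : 1 / 2 ≤ q) (ha : 0 ≤ a) (ha' : a ≤ 1 / 2)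
    (hc : 0 ≤ c) :
    (a ^ 2 + c) ^ q + ((1 / 2 - a) ^ 2 + c) ^ q ≤ c ^ q + (1 / 4 + c) ^ q := by
  have h1 := (Real.add_sq_rpow_le hq ha ha' hc).1
  have h2 := (Real.add_sq_rpow_le hq (a := 1 / 2 - a) (by linarith) (by linarith) hc).1
  linarith

theorem Real.add_sq_rpow_add_lt {q a c : ℝ} (hq : 1 / 2 ≤ q) (ha : 0 < a) (ha' : a < 1 / 2)
    (hc : 0 < c) :
    (a ^ 2 + c) ^ q + ((1 / 2 - a) ^ 2 + c) ^ q < c ^ q + (1 / 4 + c) ^ q := by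
  have h1 := (Real.add_sq_rpow_le hq ha.le ha'.le hc.le).2 ha ha' hc
  have h2 := (Real.add_sq_rpow_le hq (a := 1 / 2 - a) (by linarith) (by linarith) hc.le).1
  linarith

/-- The sum of the `2q`-th powers of the distances to the vertices of a square of side `1 / 2`, from
a point over the square, is maximal at the vertices. -/
theorem Real.square_sum_le {q a b r ρ : ℝ} (hq : 1 / 2 ≤ q) (ha : 0 ≤ a) (ha' : a ≤ 1 / 2)
    (hb : 0 ≤ b) (hb' : b ≤ 1 / 2) (hr : 0 ≤ r) (hρ : r ≤ ρ) :
    (a ^ 2 + b ^ 2 + r) ^ q + ((1 / 2 - a) ^ 2 + b ^ 2 + r) ^ q +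
        (a ^ 2 + (1 / 2 - b) ^ 2 + r) ^ q + ((1 / 2 - a) ^ 2 + (1 / 2 - b) ^ 2 + r) ^ q ≤
      ρ ^ q + 2 * (1 / 4 + ρ) ^ q + (1 / 2 + ρ) ^ q ∧
    ((a ^ 2 + b ^ 2 + r) ^ q + ((1 / 2 - a) ^ 2 + b ^ 2 + r) ^ q +
        (a ^ 2 + (1 / 2 - b) ^ 2 + r) ^ q + ((1 / 2 - a) ^ 2 + (1 / 2 - b) ^ 2 + r) ^ q =
      ρ ^ q + 2 * (1 / 4 + ρ) ^ q + (1 / 2 + ρ) ^ q ↔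
      (a = 0 ∨ a = 1 / 2) ∧ (b = 0 ∨ b = 1 / 2) ∧ r = ρ) := by
  have hq0 : 0 < q := by linarith
  have hρ0 : 0 ≤ ρ := hr.trans hρ
  have m1 : (a ^ 2 + b ^ 2 + r) ^ q ≤ (a ^ 2 + b ^ 2 + ρ) ^ q := by gcongr
  have m2 : ((1 / 2 - a) ^ 2 + b ^ 2 + r) ^ q ≤ ((1 / 2 - a) ^ 2 + b ^ 2 + ρ) ^ q := by gcongr
  have m3 : (a ^ 2 + (1 / 2 - b) ^ 2 + r) ^ q ≤ (a ^ 2 + (1 / 2 - b) ^ 2 + ρ) ^ q := by gcongr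
  have m4 : ((1 / 2 - a) ^ 2 + (1 / 2 - b) ^ 2 + r) ^ q ≤
    ((1 / 2 - a) ^ 2 + (1 / 2 - b) ^ 2 + ρ) ^ q := by gcongr
  have p1 := Real.add_sq_rpow_add_le hq ha ha' (c := b ^ 2 + ρ) (by positivity)
  have p2 := Real.add_sq_rpow_add_le hq ha ha' (c := (1 / 2 - b) ^ 2 + ρ) (by positivity)
  have p3 := Real.add_sq_rpow_add_le hq hb hb' (c := ρ) (by positivity)
  have p4 := Real.add_sq_rpow_add_le hq hb hb' (c := 1 / 4 + ρ) (by positivity)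
  have e1 : 1 / 4 + (b ^ 2 + ρ) = b ^ 2 + (1 / 4 + ρ) := by ring
  have e2 : 1 / 4 + ((1 / 2 - b) ^ 2 + ρ) = (1 / 2 - b) ^ 2 + (1 / 4 + ρ) := by ring
  have e3 : 1 / 4 + (1 / 4 + ρ) = 1 / 2 + ρ := by ring
  rw [e1] at p1
  rw [e2] at p2
  rw [e3] at p4
  simp only [← add_assoc] at p1 p2 p3 p4
  simp only [add_assoc _ (1 / 4 : ℝ) ρ] at p1 p2 p3 p4
  refine ⟨by linarith, fun h => ?_, ?_⟩
  · have hrρ : r = ρ := by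
      by_contra hne
      have : (a ^ 2 + b ^ 2 + r) ^ q < (a ^ 2 + b ^ 2 + ρ) ^ q := by
        have := lt_of_le_of_ne hρ hne
        gcongr
      linarith
    refine ⟨?_, ?_, hrρ⟩
    · by_contra! hne
      have h1 := lt_of_le_of_ne ha hne.1.symm
      have h2 := lt_of_le_of_ne ha' hne.2
      -- The strict inequality needs a positive offset. For `b = 0` and `ρ = 0` the row with offset
      -- `b² + ρ` does not provide one, but the row with `(1/2 - b)² + ρ` does.
      rcases eq_or_lt_of_le hb with hb0 | hb0
      · have h3 := Real.add_sq_rpow_add_lt hq h1 h2 (c := (1 / 2 - b) ^ 2 + ρ)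
          (by rw [← hb0]; positivity)
        rw [e2] at h3
        simp only [← add_assoc] at h3
        simp only [add_assoc _ (1 / 4 : ℝ) ρ] at h3
        linarith
      · have h3 := Real.add_sq_rpow_add_lt hq h1 h2 (c := b ^ 2 + ρ) (by positivity)
        rw [e1] at h3
        simp only [← add_assoc] at h3
        simp only [add_assoc _ (1 / 4 : ℝ) ρ] at h3
        linarith
    · by_contra! hne
      have h1 := lt_of_le_of_ne hb hne.1.symm
      have h2 := lt_of_le_of_ne hb' hne.2
      have h3 := Real.add_sq_rpow_add_lt hq h1 h2 (c := 1 / 4 + ρ) (by positivity)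
      rw [e3] at h3
      simp only [← add_assoc] at h3
      simp only [add_assoc _ (1 / 4 : ℝ) ρ] at h3
      linarith
  · rintro ⟨rfl | rfl, rfl | rfl, rfl⟩ <;> norm_num <;> ring_nf

/-- With `q = p / 2`, this function is the best saving as a function of the squared distance in the
remaining coordinates. Its derivative has the sign of the monotonicity of `s ^ (q - 1)`, which is
what separates `p < 2`, `p = 2` and `p > 2`. -/
theorem Real.strictMonoOn_add_rpow_sub_rpow {q : ℝ} (hq : 1 < q) :
    StrictMonoOn (fun s : ℝ => (1 / 2 + s) ^ q - s ^ q) (Set.Ici 0) := by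
  refine strictMonoOn_of_deriv_pos (convex_Ici 0) ?_ fun s hs => ?_
  · exact ((continuous_const.add continuous_id).rpow_const fun _ => Or.inr (by linarith)).sub
      (continuous_id.rpow_const fun _ => Or.inr (by linarith)) |>.continuousOn
  · rw [interior_Ici, Set.mem_Ioi] at hs
    have h1 : HasDerivAt (fun s : ℝ => (1 / 2 + s) ^ q - s ^ q)
        (1 * q * (1 / 2 + s) ^ (q - 1) - q * s ^ (q - 1)) s :=
      (((hasDerivAt_id s).const_add (1 / 2)).rpow_const (Or.inl (by positivity))).sub
        (Real.hasDerivAt_rpow_const (Or.inl hs.ne'))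
    rw [h1.deriv]
    have : s ^ (q - 1) < (1 / 2 + s) ^ (q - 1) :=
      Real.rpow_lt_rpow hs.le (by linarith) (by linarith)
    nlinarith

theorem Real.strictAntiOn_add_rpow_sub_rpow {q : ℝ} (hq0 : 0 < q) (hq : q < 1) :
    StrictAntiOn (fun s : ℝ => (1 / 2 + s) ^ q - s ^ q) (Set.Ici 0) := by
  refine strictAntiOn_of_deriv_neg (convex_Ici 0) ?_ fun s hs => ?_
  · exact ((continuous_const.add continuous_id).rpow_const fun _ => Or.inr (by linarith)).sub
      (continuous_id.rpow_const fun _ => Or.inr (by linarith)) |>.continuousOn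
  · rw [interior_Ici, Set.mem_Ioi] at hs
    have h1 : HasDerivAt (fun s : ℝ => (1 / 2 + s) ^ q - s ^ q)
        (1 * q * (1 / 2 + s) ^ (q - 1) - q * s ^ (q - 1)) s :=
      (((hasDerivAt_id s).const_add (1 / 2)).rpow_const (Or.inl (by positivity))).sub
        (Real.hasDerivAt_rpow_const (Or.inl hs.ne'))
    rw [h1.deriv]
    have : (1 / 2 + s) ^ (q - 1) < s ^ (q - 1) :=
      Real.rpow_lt_rpow_of_neg hs (by linarith) (by linarith)
    nlinarith

end RealInequalities

/-! ### The flat torus and its half-translations -/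

section Torus

theorem UnitAddCircle.dist_le_half (x y : UnitAddCircle) : dist x y ≤ 1 / 2 := by
  rw [dist_eq_norm]
  simpa using AddCircle.norm_le_half_period (p := (1 : ℝ)) (x := x - y) one_ne_zero

/-- Checked on the representative in `[-1/2, 1/2)`. Through this identity all distances to
half-translates of `x` become functions of the coordinate distances to `x`. -/
theorem UnitAddCircle.norm_sub_half (z : UnitAddCircle) :
    ‖z - ((1 / 2 : ℝ) : UnitAddCircle)‖ = 1 / 2 - ‖z‖ := by
  have hn : ∀ r : ℝ, |r| ≤ 1 / 2 → ‖(r : UnitAddCircle)‖ = |r| := fun r hr =>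
    (AddCircle.norm_coe_eq_abs_iff (1 : ℝ) one_ne_zero).2 (by simpa using hr)
  obtain ⟨r, hr, rfl⟩ : z ∈ ((↑) : ℝ → UnitAddCircle) '' Set.Ico (-(1 / 2)) (-(1 / 2) + 1) := by
    rw [AddCircle.coe_image_Ico_eq]; trivial
  obtain ⟨h1, h2⟩ := hr
  rw [hn r (abs_le.2 ⟨by linarith, by linarith⟩)]
  rcases le_total 0 r with h | h
  · rw [← AddCircle.coe_sub, hn _ (abs_le.2 ⟨by linarith, by linarith⟩), abs_of_nonneg h,
      abs_of_nonpos (by linarith)]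
    ring
  · have : (r : UnitAddCircle) - ((1 / 2 : ℝ) : UnitAddCircle) = ((r + 1 / 2 : ℝ) : UnitAddCircle) := by
      rw [← AddCircle.coe_sub, ← AddCircle.coe_add_period 1 (r - 1 / 2)]
      congr 1
      ring
    rw [this, hn _ (abs_le.2 ⟨by linarith, by linarith⟩), abs_of_nonpos h,
      abs_of_nonneg (by linarith)]
    ring

theorem UnitAddCircle.dist_add_half (x y : UnitAddCircle) :
    dist y (x + ((1 / 2 : ℝ) : UnitAddCircle)) = 1 / 2 - dist y x := by
  rw [dist_eq_norm, dist_eq_norm, ← UnitAddCircle.norm_sub_half, sub_sub]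

variable {n : ℕ}

instance : CompactSpace (FlatTorus n) :=
  (PiLp.homeomorph 2 fun _ : Fin n => UnitAddCircle).symm.compactSpace

/-- The translation of the torus by `1 / 2` in the coordinates that belong to `S`. -/
noncomputable def halfShift (S : Finset (Fin n)) (x : FlatTorus n) : FlatTorus n :=
  WithLp.toLp 2 fun k => if k ∈ S then x k + ((1 / 2 : ℝ) : UnitAddCircle) else x k

theorem halfShift_empty (x : FlatTorus n) : halfShift ∅ x = x := by
  ext k
  simp [halfShift]

theorem dist_halfShift_apply (S : Finset (Fin n)) (x y : FlatTorus n) (k : Fin n) :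
    dist (y k) (halfShift S x k) = if k ∈ S then 1 / 2 - dist (y k) (x k) else dist (y k) (x k) := by
  simp only [halfShift]
  split_ifs
  · exact UnitAddCircle.dist_add_half _ _
  · rfl

theorem eq_halfShift_iff (S : Finset (Fin n)) (x y : FlatTorus n) :
    y = halfShift S x ↔ ∀ k, dist (y k) (x k) = if k ∈ S then 1 / 2 else 0 := by
  have h : y = halfShift S x ↔ ∀ k, dist (y k) (halfShift S x k) = 0 := by
    simp only [dist_eq_zero]
    exact ⟨fun h k => by rw [h], fun h => PiLp.ext h⟩
  rw [h]
  refine forall_congr' fun k => ?_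
  rw [dist_halfShift_apply]
  split_ifs
  · constructor <;> intro h <;> linarith
  · rfl

theorem edist_rpow_eq {p : ℝ} (hp : 0 ≤ p) (x y : FlatTorus n) :
    edist y x ^ p = ENNReal.ofReal ((∑ k, dist (y k) (x k) ^ 2) ^ (p / 2)) := by
  rw [edist_dist, ENNReal.ofReal_rpow_of_nonneg dist_nonneg hp, PiLp.dist_eq_of_L2,
    Real.sqrt_eq_rpow, ← Real.rpow_mul (by positivity)]
  congr 2
  ring

theorem edist_halfShift_rpow_eq {p : ℝ} (hp : 0 ≤ p) (S : Finset (Fin n)) (x y : FlatTorus n) :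
    edist y (halfShift S x) ^ p = ENNReal.ofReal
      ((∑ k, (if k ∈ S then 1 / 2 - dist (y k) (x k) else dist (y k) (x k)) ^ 2) ^ (p / 2)) := by
  rw [edist_rpow_eq hp]
  simp only [dist_halfShift_apply]

theorem sum_eq_add_add_sum_compl {i j : Fin n} (hij : i ≠ j) (f : Fin n → ℝ) :
    ∑ k, f k = f i + f j + ∑ k ∈ ({i, j} : Finset (Fin n))ᶜ, f k := by
  rw [← Finset.sum_add_sum_compl {i, j} f, Finset.sum_pair hij]


end Torus

/-! ### Squares in the torus and cost differences -/

namespace FlatTorus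

variable {n : ℕ} {p : ℝ}

theorem sum_compl_le {i j : Fin n} (x y : FlatTorus n) :
    ∑ k ∈ ({i, j} : Finset (Fin n))ᶜ, dist (y k) (x k) ^ 2 ≤
      ∑ _k ∈ ({i, j} : Finset (Fin n))ᶜ, (1 / 4 : ℝ) :=
  Finset.sum_le_sum fun k _ => by
    nlinarith [UnitAddCircle.dist_le_half (y k) (x k), dist_nonneg (x := y k) (y := x k)]

theorem sum_compl_eq_iff {i j : Fin n} (x y : FlatTorus n) :
    ∑ k ∈ ({i, j} : Finset (Fin n))ᶜ, dist (y k) (x k) ^ 2 =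
        ∑ _k ∈ ({i, j} : Finset (Fin n))ᶜ, (1 / 4 : ℝ) ↔
      ∀ k, k ≠ i → k ≠ j → dist (y k) (x k) = 1 / 2 := by
  rw [Finset.sum_eq_sum_iff_of_le fun k _ => by
    nlinarith [UnitAddCircle.dist_le_half (y k) (x k), dist_nonneg (x := y k) (y := x k)]]
  refine forall_congr' fun k => ?_
  simp only [Finset.mem_compl, Finset.mem_insert, Finset.mem_singleton, not_or, and_imp]
  refine forall_congr' fun _ => forall_congr' fun _ => ⟨fun h => ?_, fun h => ?_⟩
  · nlinarith [UnitAddCircle.dist_le_half (y k) (x k), dist_nonneg (x := y k) (y := x k)]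
  · rw [h]; norm_num

theorem sum_compl_eq_zero_iff {i j : Fin n} (x y : FlatTorus n) :
    ∑ k ∈ ({i, j} : Finset (Fin n))ᶜ, dist (y k) (x k) ^ 2 = 0 ↔
      ∀ k, k ≠ i → k ≠ j → dist (y k) (x k) = 0 := by
  rw [Finset.sum_eq_zero_iff_of_nonneg fun k _ => by positivity]
  refine forall_congr' fun k => ?_
  simp

theorem sum_dist_halfShift {i j : Fin n} (hij : i ≠ j) (S : Finset (Fin n)) (x y : FlatTorus n) :
    ∑ k, (if k ∈ S then 1 / 2 - dist (y k) (x k) else dist (y k) (x k)) ^ 2 =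
      (if i ∈ S then 1 / 2 - dist (y i) (x i) else dist (y i) (x i)) ^ 2 +
      (if j ∈ S then 1 / 2 - dist (y j) (x j) else dist (y j) (x j)) ^ 2 +
      ∑ k ∈ ({i, j} : Finset (Fin n))ᶜ,
        (if k ∈ S then 1 / 2 - dist (y k) (x k) else dist (y k) (x k)) ^ 2 :=
  sum_eq_add_add_sum_compl hij _

theorem edist_halfShift_of_subset (hp : 0 ≤ p) {i j : Fin n} (hij : i ≠ j) {S : Finset (Fin n)}
    (hS : S ⊆ {i, j}) (x y : FlatTorus n) :
    edist y (halfShift S x) ^ p = ENNReal.ofReal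
      (((if i ∈ S then 1 / 2 - dist (y i) (x i) else dist (y i) (x i)) ^ 2 +
        (if j ∈ S then 1 / 2 - dist (y j) (x j) else dist (y j) (x j)) ^ 2 +
        ∑ k ∈ ({i, j} : Finset (Fin n))ᶜ, dist (y k) (x k) ^ 2) ^ (p / 2)) := by
  rw [edist_halfShift_rpow_eq hp, sum_dist_halfShift hij]
  congr 3
  refine Finset.sum_congr rfl fun k hk => ?_
  rw [if_neg fun h => Finset.mem_compl.1 hk (hS h)]

theorem edist_halfShift_union_compl (hp : 0 ≤ p) {i j : Fin n} (hij : i ≠ j)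
    (S : Finset (Fin n)) (x y : FlatTorus n) :
    edist y (halfShift (S ∪ {i, j}ᶜ) x) ^ p = ENNReal.ofReal
      (((if i ∈ S then 1 / 2 - dist (y i) (x i) else dist (y i) (x i)) ^ 2 +
        (if j ∈ S then 1 / 2 - dist (y j) (x j) else dist (y j) (x j)) ^ 2 +
        ∑ k ∈ ({i, j} : Finset (Fin n))ᶜ, (1 / 2 - dist (y k) (x k)) ^ 2) ^ (p / 2)) := by
  rw [edist_halfShift_rpow_eq hp, sum_dist_halfShift hij]
  congr 3
  · simp
  · refine Finset.sum_congr rfl fun k hk => ?_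
    rw [if_pos (Finset.mem_union_right _ hk)]

theorem exists_farthest (hp : 1 ≤ p) {i j : Fin n} (hij : i ≠ j) (x : FlatTorus n) :
    ∃ (v : Fin 4 → FlatTorus n) (K : ℝ≥0∞), K ≠ ∞ ∧ (∀ y, ∑ l, edist y (v l) ^ p ≤ K) ∧
      ∀ y, ∑ l, edist y (v l) ^ p = K ↔
        y ∈ ({x, halfShift {j} x, halfShift {i} x, halfShift {i, j} x} : Set (FlatTorus n)) := by
  have hp0 : 0 ≤ p := by linarith
  have hji := hij.symm
  have h0 : (∅ : Finset (Fin n)) ⊆ {i, j} := by simp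
  have hi : ({i} : Finset (Fin n)) ⊆ {i, j} := by simp
  have hj : ({j} : Finset (Fin n)) ⊆ {i, j} := by simp
  have hx0 := halfShift_empty x
  set ρ : ℝ := ∑ _k ∈ ({i, j} : Finset (Fin n))ᶜ, (1 / 4 : ℝ) with hρ
  -- The reference points are the square itself, moved by `1/2` in every other coordinate, so that
  -- being far from them forces `y` to agree with `x` in those coordinates. `K` is the value at a
  -- vertex: one distance of squared length `ρ`, two of `1/4 + ρ`, one of `1/2 + ρ`.
  refine ⟨![halfShift (∅ ∪ {i, j}ᶜ) x, halfShift ({i} ∪ {i, j}ᶜ) x, halfShift ({j} ∪ {i, j}ᶜ) x,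
    halfShift ({i, j} ∪ {i, j}ᶜ) x],
    ENNReal.ofReal (ρ ^ (p / 2) + 2 * (1 / 4 + ρ) ^ (p / 2) + (1 / 2 + ρ) ^ (p / 2)),
    ENNReal.ofReal_ne_top, ?_⟩
  have hρ0 : 0 ≤ ρ := Finset.sum_nonneg fun _ _ => by norm_num
  have hsum : ∀ y, ∑ l, edist y ((![halfShift (∅ ∪ {i, j}ᶜ) x, halfShift ({i} ∪ {i, j}ᶜ) x,
      halfShift ({j} ∪ {i, j}ᶜ) x, halfShift ({i, j} ∪ {i, j}ᶜ) x] : Fin 4 → FlatTorus n) l) ^ p =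
      ENNReal.ofReal
      ((dist (y i) (x i) ^ 2 + dist (y j) (x j) ^ 2 +
        ∑ k ∈ ({i, j} : Finset (Fin n))ᶜ, (1 / 2 - dist (y k) (x k)) ^ 2) ^ (p / 2) +
      ((1 / 2 - dist (y i) (x i)) ^ 2 + dist (y j) (x j) ^ 2 +
        ∑ k ∈ ({i, j} : Finset (Fin n))ᶜ, (1 / 2 - dist (y k) (x k)) ^ 2) ^ (p / 2) +
      (dist (y i) (x i) ^ 2 + (1 / 2 - dist (y j) (x j)) ^ 2 +
        ∑ k ∈ ({i, j} : Finset (Fin n))ᶜ, (1 / 2 - dist (y k) (x k)) ^ 2) ^ (p / 2) +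
      ((1 / 2 - dist (y i) (x i)) ^ 2 + (1 / 2 - dist (y j) (x j)) ^ 2 +
        ∑ k ∈ ({i, j} : Finset (Fin n))ᶜ, (1 / 2 - dist (y k) (x k)) ^ 2) ^ (p / 2)) := by
    intro y
    rw [ENNReal.ofReal_add (by positivity) (by positivity),
      ENNReal.ofReal_add (by positivity) (by positivity),
      ENNReal.ofReal_add (by positivity) (by positivity), Fin.sum_univ_four]
    simp only [Matrix.cons_val]
    simp only [edist_halfShift_union_compl hp0 hij]
    simp [hij, hji]
  have hle : ∀ y : FlatTorus n, ∀ k,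
      (1 / 2 - dist (y k) (x k)) ^ 2 ≤ 1 / 4 := fun y k => by
    nlinarith [UnitAddCircle.dist_le_half (y k) (x k), dist_nonneg (x := y k) (y := x k)]
  have hkey := fun y : FlatTorus n => Real.square_sum_le (q := p / 2) (by linarith)
    dist_nonneg (UnitAddCircle.dist_le_half (y i) (x i)) dist_nonneg
    (UnitAddCircle.dist_le_half (y j) (x j))
    (show 0 ≤ ∑ k ∈ ({i, j} : Finset (Fin n))ᶜ, (1 / 2 - dist (y k) (x k)) ^ 2 by positivity)
    (show _ ≤ ρ from Finset.sum_le_sum fun k _ => hle y k)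
  refine ⟨fun y => ?_, fun y => ?_⟩
  · rw [hsum]
    exact ENNReal.ofReal_le_ofReal (hkey y).1
  · rw [hsum, ENNReal.ofReal_eq_ofReal_iff (by positivity) (by positivity), (hkey y).2, hρ,
      Finset.sum_eq_sum_iff_of_le fun k _ => hle y k]
    have hrest : (∀ k ∈ ({i, j} : Finset (Fin n))ᶜ, (1 / 2 - dist (y k) (x k)) ^ 2 = 1 / 4) ↔
        ∀ k, k ≠ i → k ≠ j → dist (y k) (x k) = 0 := by
      refine forall_congr' fun k => ?_
      simp only [Finset.mem_compl, Finset.mem_insert, Finset.mem_singleton, not_or, and_imp]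
      refine forall_congr' fun _ => forall_congr' fun _ => ⟨fun h => ?_, fun h => ?_⟩
      · nlinarith [UnitAddCircle.dist_le_half (y k) (x k), dist_nonneg (x := y k) (y := x k)]
      · rw [h]; norm_num
    have hmem : ∀ S : Finset (Fin n), S ⊆ {i, j} → (y = halfShift S x ↔
        dist (y i) (x i) = (if i ∈ S then 1 / 2 else 0) ∧
        dist (y j) (x j) = (if j ∈ S then 1 / 2 else 0) ∧
        ∀ k, k ≠ i → k ≠ j → dist (y k) (x k) = 0) := by
      intro S hS
      rw [eq_halfShift_iff]
      constructor
      · intro h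
        refine ⟨h i, h j, fun k hki hkj => ?_⟩
        rw [h k, if_neg fun hk => ?_]
        have := hS hk
        simp [hki, hkj] at this
      · rintro ⟨h1, h2, h3⟩ k
        by_cases hki : k = i
        · rw [hki, h1]
        by_cases hkj : k = j
        · rw [hkj, h2]
        rw [h3 k hki hkj, if_neg fun hk => ?_]
        have := hS hk
        simp [hki, hkj] at this
    rw [hrest, Set.mem_insert_iff, Set.mem_insert_iff, Set.mem_insert_iff, Set.mem_singleton_iff,
      hmem _ hj, hmem _ hi, hmem _ subset_rfl]
    have hx := hmem _ h0
    rw [hx0] at hx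
    rw [hx]
    simp only [Finset.notMem_empty, if_false, Finset.mem_singleton, Finset.mem_insert, hij, hji,
      if_true, true_or, or_true]
    clear * -
    generalize dist (y i) (x i) = a
    generalize dist (y j) (x j) = b
    generalize (∀ k, k ≠ i → k ≠ j → dist (y k) (x k) = 0) = P
    tauto

theorem isFarthestSquare (hp : 1 ≤ p) {i j : Fin n} (hij : i ≠ j) (x : FlatTorus n) :
    IsFarthestSquare p ((1 / 4) ^ (p / 2)) ((1 / 2) ^ (p / 2)) x (halfShift {j} x)
      (halfShift {i} x) (halfShift {i, j} x) := by
  have hp0 : 0 ≤ p := by linarith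
  have hp2 : p / 2 ≠ 0 := by positivity
  have hji := hij.symm
  have hval : ∀ {S S' : Finset (Fin n)}, S ⊆ {i, j} → S' ⊆ {i, j} →
      edist (halfShift S x) (halfShift S' x) ^ p = ENNReal.ofReal
        (((if (i ∈ S ↔ i ∈ S') then 0 else 1 / 4) + (if (j ∈ S ↔ j ∈ S') then 0 else 1 / 4)) ^
          (p / 2)) := by
    intro S S' hS hS'
    have hx : ∀ k, dist (halfShift S x k) (x k) = if k ∈ S then 1 / 2 else 0 :=
      (eq_halfShift_iff S x _).1 rfl
    rw [edist_halfShift_of_subset hp0 hij hS']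
    simp only [hx]
    rw [Finset.sum_eq_zero fun k hk => by
      rw [if_neg fun h => Finset.mem_compl.1 hk (hS h)]; norm_num]
    congr 2
    by_cases h1 : i ∈ S <;> by_cases h2 : i ∈ S' <;> by_cases h3 : j ∈ S <;> by_cases h4 : j ∈ S' <;>
      simp [h1, h2, h3, h4] <;> norm_num
  have h0 : (∅ : Finset (Fin n)) ⊆ {i, j} := by simp
  have hi : ({i} : Finset (Fin n)) ⊆ {i, j} := by simp
  have hj : ({j} : Finset (Fin n)) ⊆ {i, j} := by simp
  have hx0 := halfShift_empty x
  refine ⟨by positivity, ?_, ?_, ?_, ?_, ?_, ?_, ?_, ?_⟩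
  · gcongr; norm_num
  · have := hval h0 hj; rw [hx0] at this; rw [this]; simp [hij]
  · rw [hval hi subset_rfl]; simp [hji]
  · have := hval h0 hi; rw [hx0] at this; rw [this]; simp [hji]
  · rw [hval hj subset_rfl]; simp [hij]
  · have := hval h0 subset_rfl; rw [hx0] at this; rw [this]; norm_num
  · rw [hval hj hi]; simp [hij, hji]; norm_num
  · exact exists_farthest hp hij x

/-- At `a = b = 0` the left power is as large and the right one as small as possible, so only the
dependence on `r` is left. -/
theorem _root_.Real.half_sub_rpow_le {q a b r M : ℝ} (hq : 0 < q) (ha0 : 0 ≤ a) (ha1 : a ≤ 1 / 2)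
    (hb0 : 0 ≤ b) (hb1 : b ≤ 1 / 2) (hr : 0 ≤ r) (hM : (1 / 2 + r) ^ q - r ^ q ≤ M) :
    ((1 / 2 - a) ^ 2 + (1 / 2 - b) ^ 2 + r) ^ q ≤ (a ^ 2 + b ^ 2 + r) ^ q + M ∧
    (((1 / 2 - a) ^ 2 + (1 / 2 - b) ^ 2 + r) ^ q = (a ^ 2 + b ^ 2 + r) ^ q + M ↔
      a = 0 ∧ b = 0 ∧ (1 / 2 + r) ^ q - r ^ q = M) := by
  have ha2 : (1 / 2 - a) ^ 2 ≤ 1 / 4 := by nlinarith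
  have hb2 : (1 / 2 - b) ^ 2 ≤ 1 / 4 := by nlinarith
  have ha3 := sq_nonneg a
  have hb3 := sq_nonneg b
  have m1 : ((1 / 2 - a) ^ 2 + (1 / 2 - b) ^ 2 + r) ^ q ≤ (1 / 2 + r) ^ q :=
    Real.rpow_le_rpow (by positivity) (by linarith) hq.le
  have m2 : r ^ q ≤ (a ^ 2 + b ^ 2 + r) ^ q := Real.rpow_le_rpow hr (by linarith) hq.le
  refine ⟨by linarith, fun h => ?_, ?_⟩
  · have h3 : r ^ q = (a ^ 2 + b ^ 2 + r) ^ q := by linarith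
    have h4 := (Real.rpow_left_inj hr (by positivity) hq.ne').1 h3
    exact ⟨pow_eq_zero_iff two_ne_zero |>.1 (by linarith),
      pow_eq_zero_iff two_ne_zero |>.1 (by linarith), by linarith⟩
  · rintro ⟨rfl, rfl, rfl⟩
    norm_num

theorem edist_halfShift_pair_le (hp : 0 < p) {i j : Fin n} (hij : i ≠ j) (x : FlatTorus n) {M : ℝ}
    (hM0 : 0 ≤ M)
    (hM : ∀ y : FlatTorus n,
      (1 / 2 + ∑ k ∈ ({i, j} : Finset (Fin n))ᶜ, dist (y k) (x k) ^ 2) ^ (p / 2) -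
        (∑ k ∈ ({i, j} : Finset (Fin n))ᶜ, dist (y k) (x k) ^ 2) ^ (p / 2) ≤ M)
    (y : FlatTorus n) :
    edist y (halfShift {i, j} x) ^ p ≤ edist y x ^ p + ENNReal.ofReal M ∧
    (edist y (halfShift {i, j} x) ^ p = edist y x ^ p + ENNReal.ofReal M ↔
      y i = x i ∧ y j = x j ∧
      (1 / 2 + ∑ k ∈ ({i, j} : Finset (Fin n))ᶜ, dist (y k) (x k) ^ 2) ^ (p / 2) -
        (∑ k ∈ ({i, j} : Finset (Fin n))ᶜ, dist (y k) (x k) ^ 2) ^ (p / 2) = M) := by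
  have h1 := edist_halfShift_of_subset hp.le hij subset_rfl x y
  have h2 := edist_halfShift_of_subset hp.le hij (Finset.empty_subset _) x y
  rw [halfShift_empty] at h2
  have hji := hij.symm
  simp only [Finset.notMem_empty, if_false, Finset.mem_singleton, Finset.mem_insert,
        if_true, true_or, or_true] at h1 h2
  obtain ⟨h3, h4⟩ := Real.half_sub_rpow_le (half_pos hp) dist_nonneg
    (UnitAddCircle.dist_le_half (y i) (x i)) dist_nonneg (UnitAddCircle.dist_le_half (y j) (x j))
    (Finset.sum_nonneg fun k _ => sq_nonneg _) (hM y)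
  rw [h1, h2, ← ENNReal.ofReal_add (by positivity) hM0]
  refine ⟨ENNReal.ofReal_le_ofReal h3, ?_⟩
  rw [ENNReal.ofReal_eq_ofReal_iff (by positivity) (by positivity), h4, dist_eq_zero, dist_eq_zero]

end FlatTorus

/-! ### Dirac masses and antipodes; reduction to Dirac-fixing isometries -/

namespace WassersteinSpace

section Dirac

variable {X : Type*} [MetricSpace X] [MeasurableSpace X] [BorelSpace X]
  [SecondCountableTopology X] [CompactSpace X] {p : ℝ}

/-- The images of `δ_x` and `δ_(σ x)` are at the maximal cost `K`, so even their product coupling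
lives on pairs at maximal distance. Fixing one coordinate `y` confines the other to the single point
`σ y`. -/
theorem exists_map_dirac (hp : 0 < p) {K : ℝ≥0∞} (hK : K ≠ ∞) {σ : X → X}
    (hle : ∀ x y : X, edist x y ^ p ≤ K) (heq : ∀ x y : X, edist x y ^ p = K ↔ y = σ x)
    {F : Equiv.Perm (WassersteinSpace p X)}
    (hF : ∀ μ ν, transportCost p (F μ).toMeasure (F ν).toMeasure =
      transportCost p μ.toMeasure ν.toMeasure) (x : X) :
    ∃ y, F (ofMeasure hp.le (Measure.dirac x)) = ofMeasure hp.le (Measure.dirac y) := by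
  set μ := F (ofMeasure hp.le (Measure.dirac x))
  set ν := F (ofMeasure hp.le (Measure.dirac (σ x)))
  have hcost : K ≤ ∫⁻ z, edist z.1 z.2 ^ p ∂(ν.toMeasure.prod μ.toMeasure) := by
    refine le_trans (le_of_eq ?_) (transportCost_le_prod ν.toMeasure μ.toMeasure)
    rw [hF, toMeasure_ofMeasure, toMeasure_ofMeasure, transportCost_dirac_dirac, edist_comm, eq_comm]
    exact (heq x (σ x)).2 rfl
  have hint : ∫⁻ z, edist z.1 z.2 ^ p ∂(ν.toMeasure.prod μ.toMeasure) ≠ ∞ :=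
    ne_top_of_le_ne_top hK (by
      calc _ ≤ ∫⁻ _, K ∂(ν.toMeasure.prod μ.toMeasure) := lintegral_mono fun z => hle z.1 z.2
        _ = K := by simp)
  have hae := ae_eq_of_ae_le_of_lintegral_le (μ := ν.toMeasure.prod μ.toMeasure)
    (f := fun z => edist z.1 z.2 ^ p) (g := fun _ => K) (.of_forall fun z => hle z.1 z.2) hint
    aemeasurable_const (by simpa using hcost)
  obtain ⟨y, hy⟩ := (Measure.ae_ae_of_ae_prod hae).exists
  refine ⟨σ y, toMeasure_injective ?_⟩
  have hy' : ∀ᵐ z ∂μ.toMeasure, z ∈ ({σ y} : Set X) := by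
    filter_upwards [hy] with z hz
    exact (heq y z).1 hz
  refine measure_eq_of_singleton_eq (Set.finite_singleton (σ y)) hy' ?_
  rintro z rfl
  rw [(mem_ae_iff_prob_eq_one (measurableSet_singleton _)).1 hy', toMeasure_ofMeasure]
  simp

theorem ofMeasure_dirac_injective (hp : 0 < p) {x y : X}
    (h : ofMeasure hp.le (Measure.dirac x) = ofMeasure hp.le (Measure.dirac y)) : x = y := by
  have h1 := congrArg (fun μ => toMeasure μ {x}) h
  simp only [toMeasure_ofMeasure, Measure.dirac_apply' _ (measurableSet_singleton x)] at h1
  by_contra hne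
  simp [Ne.symm hne] at h1

/-- Over a space with antipodes, a cost preserving bijection of the Wasserstein space restricts to
an isometry of the base on the Dirac masses. -/
theorem exists_isometryEquiv_map_dirac (hp : 0 < p) {K : ℝ≥0∞} (hK : K ≠ ∞) {σ : X → X}
    (hle : ∀ x y : X, edist x y ^ p ≤ K) (heq : ∀ x y : X, edist x y ^ p = K ↔ y = σ x)
    {F : Equiv.Perm (WassersteinSpace p X)}
    (hF : ∀ μ ν, transportCost p (F μ).toMeasure (F ν).toMeasure =
      transportCost p μ.toMeasure ν.toMeasure) :
    ∃ ψ : X ≃ᵢ X, ∀ x,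
      F (ofMeasure hp.le (Measure.dirac x)) = ofMeasure hp.le (Measure.dirac (ψ x)) := by
  have hF' : ∀ μ ν, transportCost p (F.symm μ).toMeasure (F.symm ν).toMeasure =
      transportCost p μ.toMeasure ν.toMeasure := fun μ ν => by
    rw [← hF, F.apply_symm_apply, F.apply_symm_apply]
  choose ψ hψ using exists_map_dirac hp hK hle heq hF
  have hiso : Isometry ψ := fun x y => by
    have h := hF (ofMeasure hp.le (Measure.dirac x)) (ofMeasure hp.le (Measure.dirac y))
    rw [hψ, hψ] at h
    simp only [toMeasure_ofMeasure, transportCost_dirac_dirac] at h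
    exact ENNReal.rpow_left_injective hp.ne' h
  have hsurj : Function.Surjective ψ := fun y => by
    obtain ⟨x, hx⟩ := exists_map_dirac hp hK hle heq hF' y
    refine ⟨x, ofMeasure_dirac_injective hp ?_⟩
    rw [← hψ, ← hx, F.apply_symm_apply]
  exact ⟨⟨Equiv.ofBijective ψ ⟨hiso.injective, hsurj⟩, hiso⟩, hψ⟩

theorem pushforward_ofMeasure_dirac (hp : 0 ≤ p) (ψ : X ≃ᵢ X) (x : X) :
    pushforward ψ (ofMeasure hp (Measure.dirac x)) = ofMeasure hp (Measure.dirac (ψ x)) :=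
  toMeasure_injective (by
    rw [toMeasure_pushforward, toMeasure_ofMeasure, toMeasure_ofMeasure,
      Measure.map_dirac' ψ.continuous.measurable])

theorem pushforwardHom_injective (hp : 0 < p) : Function.Injective (pushforwardHom p X) := by
  intro ψ φ h
  refine IsometryEquiv.ext fun x => ofMeasure_dirac_injective hp ?_
  rw [← pushforward_ofMeasure_dirac, ← pushforward_ofMeasure_dirac]
  exact congrArg (fun Φ : isometryGroup p X => Φ.1 (ofMeasure hp.le (Measure.dirac x))) h

/-- If the isometries that fix all Dirac masses are trivial, and Dirac masses are detected by
antipodes, then the Wasserstein space is isometrically rigid. -/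
theorem isometricallyRigid_of_isDiracFixing (hp : 0 < p) {K : ℝ≥0∞} (hK : K ≠ ∞) {σ : X → X}
    (hle : ∀ x y : X, edist x y ^ p ≤ K) (heq : ∀ x y : X, edist x y ^ p = K ↔ y = σ x)
    (htriv : ∀ F : Equiv.Perm (WassersteinSpace p X), IsDiracFixing F → F = 1) :
    IsometricallyRigid p X := by
  have hcost : ∀ Φ : isometryGroup p X, ∀ μ ν,
      transportCost p (Φ.1 μ).toMeasure (Φ.1 ν).toMeasure =
        transportCost p μ.toMeasure ν.toMeasure := fun Φ μ ν =>
    (dist_eq_dist_iff hp).1 (Φ.2 μ ν)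
  intro Φ
  obtain ⟨ψ, hψ⟩ := exists_isometryEquiv_map_dirac hp hK hle heq (hcost Φ)
  refine ⟨ψ, ?_⟩
  have h1 : IsDiracFixing ((pushforwardHom p X ψ⁻¹ * Φ : isometryGroup p X) :
      Equiv.Perm (WassersteinSpace p X)) := by
    refine ⟨hcost _, fun μ x hμ => ?_⟩
    obtain rfl : μ = ofMeasure hp.le (Measure.dirac x) := toMeasure_injective hμ
    change pushforward ψ⁻¹ (Φ.1 (ofMeasure hp.le (Measure.dirac x))) = _
    rw [hψ, pushforward_ofMeasure_dirac]
    congr 2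
    exact ψ.symm_apply_apply x
  have h2 : pushforwardHom p X ψ⁻¹ * Φ = 1 := Subtype.ext (htriv _ h1)
  rw [map_inv, inv_mul_eq_one] at h2
  exact h2

end Dirac

/-! ### Masses of points on the torus, by the size of the exponent -/

namespace IsDiracFixing

variable {n : ℕ} {p : ℝ} {F : Equiv.Perm (WassersteinSpace p (FlatTorus n))}

/-- The measure of the points `y` at which the difference of the costs of transport to `x` and to
its translate by `1 / 2` in two coordinates is minimal is preserved. -/
theorem measure_eq_of_pair (hF : IsDiracFixing F) (hp : 1 ≤ p) {i j : Fin n} (hij : i ≠ j)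
    (x : FlatTorus n) {M : ℝ} (hM0 : 0 ≤ M)
    (hM : ∀ y : FlatTorus n,
      (1 / 2 + ∑ k ∈ ({i, j} : Finset (Fin n))ᶜ, dist (y k) (x k) ^ 2) ^ (p / 2) -
        (∑ k ∈ ({i, j} : Finset (Fin n))ᶜ, dist (y k) (x k) ^ 2) ^ (p / 2) ≤ M)
    {A : Set (FlatTorus n)} (hAm : MeasurableSet A)
    (hA : ∀ y, y ∈ A ↔ y i = x i ∧ y j = x j ∧
      (1 / 2 + ∑ k ∈ ({i, j} : Finset (Fin n))ᶜ, dist (y k) (x k) ^ 2) ^ (p / 2) -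
        (∑ k ∈ ({i, j} : Finset (Fin n))ᶜ, dist (y k) (x k) ^ 2) ^ (p / 2) = M)
    (μ : WassersteinSpace p (FlatTorus n)) : (F μ).toMeasure A = μ.toMeasure A := by
  have hp0 : 0 < p := by linarith
  have hQ := FlatTorus.isFarthestSquare hp hij x
  have hpair := FlatTorus.edist_halfShift_pair_le hp0 hij x hM0 hM
  exact hF.measure_eq hp0 (hQ.distinct hp0).2.2.1 hAm ENNReal.ofReal_ne_top
    (fun y => (hpair y).1) (fun y => (hpair y).2.trans (hA y).symm)
    (fun t h0 h1 h2 => hF.fixes_diag hp0 hQ h0 h1 h2) μ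

theorem measure_singleton_of_lt_two (hF : IsDiracFixing F) (hp : 1 ≤ p) (hp2 : p < 2)
    {i j : Fin n} (hij : i ≠ j) (μ : WassersteinSpace p (FlatTorus n)) (x : FlatTorus n) :
    (F μ).toMeasure {x} = μ.toMeasure {x} := by
  have hanti := Real.strictAntiOn_add_rpow_sub_rpow (q := p / 2) (by linarith) (by linarith)
  have hr : ∀ y : FlatTorus n,
      0 ≤ ∑ k ∈ ({i, j} : Finset (Fin n))ᶜ, dist (y k) (x k) ^ 2 := fun y => by positivity
  have hM : ((1 / 2 : ℝ) + 0) ^ (p / 2) - 0 ^ (p / 2) = (1 / 2) ^ (p / 2) := by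
    rw [Real.zero_rpow (by positivity)]; simp
  refine hF.measure_eq_of_pair hp hij x (M := (1 / 2) ^ (p / 2)) (by positivity) (fun y => ?_)
    (measurableSet_singleton x) (fun y => ?_) μ
  · rw [← hM]
    exact hanti.antitoneOn Set.self_mem_Ici (hr y) (hr y)
  · rw [← hM, Set.mem_singleton_iff,
      show ((1 / 2 + ∑ k ∈ ({i, j} : Finset (Fin n))ᶜ, dist (y k) (x k) ^ 2) ^ (p / 2) -
        (∑ k ∈ ({i, j} : Finset (Fin n))ᶜ, dist (y k) (x k) ^ 2) ^ (p / 2) =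
        ((1 / 2 : ℝ) + 0) ^ (p / 2) - 0 ^ (p / 2)) ↔ _ from
        hanti.injOn.eq_iff (hr y) Set.self_mem_Ici, FlatTorus.sum_compl_eq_zero_iff]
    refine ⟨by rintro rfl; simp, fun ⟨h1, h2, h3⟩ => PiLp.ext fun k => ?_⟩
    by_cases hki : k = i
    · rwa [hki]
    by_cases hkj : k = j
    · rwa [hkj]
    exact dist_eq_zero.1 (h3 k hki hkj)

theorem measure_singleton_of_two_lt (hF : IsDiracFixing F) (hp2 : 2 < p)
    {i j : Fin n} (hij : i ≠ j) (μ : WassersteinSpace p (FlatTorus n)) (z : FlatTorus n) :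
    (F μ).toMeasure {z} = μ.toMeasure {z} := by
  have hmono := Real.strictMonoOn_add_rpow_sub_rpow (q := p / 2) (by linarith)
  -- For `p > 2` the saving is largest at distance `1/2` in all other coordinates, so the square is
  -- based at the point for which this maximum sits at `z`.
  set x := halfShift ({i, j} : Finset (Fin n))ᶜ z with hx
  have hr : ∀ y : FlatTorus n,
      0 ≤ ∑ k ∈ ({i, j} : Finset (Fin n))ᶜ, dist (y k) (x k) ^ 2 := fun y => by positivity
  set ρ := ∑ _k ∈ ({i, j} : Finset (Fin n))ᶜ, (1 / 4 : ℝ)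
  have hρ : 0 ≤ ρ := Finset.sum_nonneg fun _ _ => by norm_num
  refine hF.measure_eq_of_pair (by linarith) hij x (M := (1 / 2 + ρ) ^ (p / 2) - ρ ^ (p / 2))
    (sub_nonneg.2 (Real.rpow_le_rpow hρ (by linarith) (by linarith))) (fun y => ?_)
    (measurableSet_singleton z) (fun y => ?_) μ
  · exact hmono.monotoneOn (hr y) hρ (FlatTorus.sum_compl_le x y)
  · rw [Set.mem_singleton_iff,
      show ((1 / 2 + ∑ k ∈ ({i, j} : Finset (Fin n))ᶜ, dist (y k) (x k) ^ 2) ^ (p / 2) -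
        (∑ k ∈ ({i, j} : Finset (Fin n))ᶜ, dist (y k) (x k) ^ 2) ^ (p / 2) =
        (1 / 2 + ρ) ^ (p / 2) - ρ ^ (p / 2)) ↔ _ from
        hmono.injOn.eq_iff (hr y) hρ, FlatTorus.sum_compl_eq_iff, ← dist_eq_zero (x := y i),
        ← dist_eq_zero (x := y j)]
    have hd := dist_halfShift_apply ({i, j} : Finset (Fin n))ᶜ z y
    rw [← hx] at hd
    simp only [hd]
    refine ⟨by rintro rfl; simp +contextual, fun ⟨h1, h2, h3⟩ => PiLp.ext fun k => ?_⟩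
    by_cases hki : k = i
    · rw [hki]; simpa using h1
    by_cases hkj : k = j
    · rw [hkj]; simpa using h2
    have h4 := h3 k hki hkj
    rw [if_pos (by simp [hki, hkj])] at h4
    exact dist_eq_zero.1 (by linarith)

theorem measure_pair (hF : IsDiracFixing F) (hp : p = 2) {i j : Fin n} (hij : i ≠ j)
    (μ : WassersteinSpace p (FlatTorus n)) (x : FlatTorus n) :
    (F μ).toMeasure {y | y i = x i ∧ y j = x j} = μ.toMeasure {y | y i = x i ∧ y j = x j} := by
  have hc : ∀ k, Continuous fun y : FlatTorus n => y k := fun k =>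
    PiLp.continuous_apply 2 _ k
  have hm : MeasurableSet {y : FlatTorus n | y i = x i ∧ y j = x j} :=
    ((isClosed_eq (hc i) continuous_const).inter (isClosed_eq (hc j) continuous_const)).measurableSet
  refine hF.measure_eq_of_pair (by linarith) hij x (M := 1 / 2) (by norm_num) (fun y => ?_)
    hm (fun y => ?_) μ
  · simp [hp]
  · simp [hp]

/-- For each `k ≠ i`, the coordinate pairs of `x` and of `x'` at `(i, k)` keep their masses `t` and
`1 - t`, which exhaust the total. Almost every `y` then follows `x` or `x'` in all coordinates, the
choice being dictated by `y i`. -/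
theorem fixes_antipodal (hF : IsDiracFixing F) (hp : p = 2) {i j : Fin n} (hij : i ≠ j)
    (x : FlatTorus n) {t : ℝ} (h0 : 0 < t) (h1 : t < 1) :
    Fixes F (twoDirac x (halfShift Finset.univ x) t) := by
  intro μ hμ
  set x' := halfShift Finset.univ x with hx'
  have hc : ∀ k, Continuous fun y : FlatTorus n => y k := fun k =>
    PiLp.continuous_apply 2 _ k
  have hm : ∀ (k l : Fin n) (z : FlatTorus n), MeasurableSet {y : FlatTorus n | y k = z k ∧ y l = z l} :=
    fun k l z => ((isClosed_eq (hc k) continuous_const).inter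
      (isClosed_eq (hc l) continuous_const)).measurableSet
  have hne : ∀ k, x' k ≠ x k := fun k h => by
    have := (eq_halfShift_iff Finset.univ x x').1 hx' k
    rw [h] at this
    norm_num at this
  have hmass : ∀ k, k ≠ i →
      (F μ).toMeasure {y | y i = x i ∧ y k = x k} = ENNReal.ofReal t := fun k hk => by
    rw [hF.measure_pair hp hk.symm, hμ]
    exact twoDirac_apply_of_mem_of_notMem t (hm i k x) ⟨rfl, rfl⟩ fun h => hne i h.1
  have hmass' : ∀ k, k ≠ i →
      (F μ).toMeasure {y | y i = x' i ∧ y k = x' k} = ENNReal.ofReal (1 - t) := fun k hk => by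
    rw [hF.measure_pair hp hk.symm, hμ, twoDirac_symm]
    exact twoDirac_apply_of_mem_of_notMem _ (hm i k x') ⟨rfl, rfl⟩ fun h => hne i h.1.symm
  have hae : ∀ k, k ≠ i → ∀ᵐ y ∂(F μ).toMeasure,
      (y i = x i ∧ y k = x k) ∨ (y i = x' i ∧ y k = x' k) := fun k hk => by
    refine (mem_ae_iff_prob_eq_one ((hm i k x).union (hm i k x'))).2 ?_
    rw [measure_union _ (hm i k x'), hmass k hk, hmass' k hk,
      ← ENNReal.ofReal_add h0.le (by linarith), add_sub_cancel, ENNReal.ofReal_one]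
    refine Set.disjoint_left.2 fun y hy hy' => hne i ?_
    exact hy'.1.symm.trans hy.1
  have hae2 : ∀ᵐ y ∂(F μ).toMeasure, y ∈ ({x, x'} : Set (FlatTorus n)) := by
    have h2 : ∀ᵐ y ∂(F μ).toMeasure, ∀ k, k ≠ i →
        (y i = x i ∧ y k = x k) ∨ (y i = x' i ∧ y k = x' k) :=
      ae_all_iff.2 fun k => by
        by_cases hk : k = i
        · exact .of_forall fun y h => absurd hk h
        · filter_upwards [hae k hk] with y hy _ using hy
    filter_upwards [h2] with y hy
    by_cases hyi : y i = x i
    · refine Or.inl (PiLp.ext fun k => ?_)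
      by_cases hk : k = i
      · rwa [hk]
      · rcases hy k hk with h | h
        · exact h.2
        · exact absurd (h.1.symm.trans hyi) (hne i)
    · refine Or.inr (PiLp.ext fun k => ?_)
      have h3 : ∀ k, k ≠ i → y i = x' i ∧ y k = x' k := fun k hk =>
        (hy k hk).resolve_left fun h => hyi h.1
      by_cases hk : k = i
      -- The value at `i` itself is read off from the pair `(i, j)`: a second coordinate is needed
      -- here.
      · rw [hk]; exact (h3 j hij.symm).1
      · exact (h3 k hk).2
  have hsing : ∀ z ∈ ({x, x'} : Set (FlatTorus n)), (F μ).toMeasure {z} =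
      (F μ).toMeasure {y | y i = z i ∧ y j = z j} := fun z hz => measure_congr <| by
    filter_upwards [hae2] with y hy
    refine propext ⟨fun h => ?_, fun h => ?_⟩
    · obtain rfl : y = z := h
      exact ⟨rfl, rfl⟩
    · have h4 : y i = z i := h.1
      rcases hy with rfl | rfl <;> rcases hz with rfl | rfl
      · rfl
      · exact absurd h4.symm (hne i)
      · exact absurd h4 (hne i)
      · rfl
  refine toMeasure_injective (measure_eq_of_singleton_eq (Set.toFinite {x, x'}) hae2 ?_)
  rintro z (rfl | rfl)
  · rw [hsing _ (by simp), hmass j hij.symm, hμ]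
    exact (twoDirac_apply_of_mem_of_notMem t (measurableSet_singleton _) rfl
      fun h => hne i (congrArg (fun y : FlatTorus n => y i) h)).symm
  · rw [hsing _ (by simp), hmass' j hij.symm, hμ, twoDirac_symm]
    exact (twoDirac_apply_of_mem_of_notMem _ (measurableSet_singleton _) rfl
      fun h => hne i (congrArg (fun y : FlatTorus n => y i) h).symm).symm

/-- For squared distances to `x` and its antipode the saving splits over coordinates into `1/4 - d(y
k, x k)`, which is maximal in every coordinate only at `y = x`. -/
theorem measure_singleton_of_eq_two (hF : IsDiracFixing F) (hp : p = 2)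
    {i j : Fin n} (hij : i ≠ j) (μ : WassersteinSpace p (FlatTorus n)) (x : FlatTorus n) :
    (F μ).toMeasure {x} = μ.toMeasure {x} := by
  have hp0 : 0 < p := by linarith
  have hne : x ≠ halfShift Finset.univ x := fun h => by
    have := (eq_halfShift_iff Finset.univ x x).1 h i
    norm_num at this
  have hM : 0 ≤ ∑ _k : Fin n, (1 / 4 : ℝ) := Finset.sum_nonneg fun _ _ => by norm_num
  have hterm : ∀ (y : FlatTorus n) k,
      (1 / 2 - dist (y k) (x k)) ^ 2 ≤ dist (y k) (x k) ^ 2 + 1 / 4 := fun y k => by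
    nlinarith [dist_nonneg (x := y k) (y := x k)]
  have hx : ∀ y : FlatTorus n, edist y x ^ p + ENNReal.ofReal (∑ _k : Fin n, (1 / 4 : ℝ)) =
      ENNReal.ofReal (∑ k, (dist (y k) (x k) ^ 2 + 1 / 4)) := fun y => by
    rw [edist_rpow_eq hp0.le, hp, ← ENNReal.ofReal_add (by positivity) hM, Finset.sum_add_distrib]
    norm_num
  have hx' : ∀ y : FlatTorus n, edist y (halfShift Finset.univ x) ^ p =
      ENNReal.ofReal (∑ k, (1 / 2 - dist (y k) (x k)) ^ 2) := fun y => by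
    rw [edist_halfShift_rpow_eq hp0.le, hp]
    simp
  refine hF.measure_eq hp0 hne (measurableSet_singleton x)
    (M := ENNReal.ofReal (∑ _k : Fin n, (1 / 4 : ℝ))) ENNReal.ofReal_ne_top
    (fun y => ?_) (fun y => ?_) (fun t h0 h1 _ => hF.fixes_antipodal hp hij x h0 h1) μ
  · rw [hx, hx']
    exact ENNReal.ofReal_le_ofReal (Finset.sum_le_sum fun k _ => hterm y k)
  · rw [hx, hx', ENNReal.ofReal_eq_ofReal_iff (by positivity) (by positivity),
      Finset.sum_eq_sum_iff_of_le fun k _ => hterm y k]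
    refine ⟨fun h => PiLp.ext fun k => dist_eq_zero.1 ?_, ?_⟩
    · linarith [h k (Finset.mem_univ k)]
    · rintro rfl k _
      norm_num

theorem eq_one (hF : IsDiracFixing F) (hp : 1 ≤ p) (hn : 2 ≤ n) : F = 1 := by
  have hij : (⟨0, by omega⟩ : Fin n) ≠ ⟨1, by omega⟩ := by simp
  refine hF.eq_one_of_measure_singleton (by linarith) fun μ x => ?_
  rcases lt_trichotomy p 2 with h | h | h
  · exact hF.measure_singleton_of_lt_two hp h hij μ x
  · exact hF.measure_singleton_of_eq_two h hij μ x
  · exact hF.measure_singleton_of_two_lt h hij μ x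

end IsDiracFixing
end WassersteinSpace

/-! ### Antipodes in the torus and the conclusion -/

theorem FlatTorus.edist_rpow_le {n : ℕ} {p : ℝ} (hp : 0 < p) (x y : FlatTorus n) :
    edist x y ^ p ≤ ENNReal.ofReal ((∑ _k : Fin n, (1 / 4 : ℝ)) ^ (p / 2)) ∧
    (edist x y ^ p = ENNReal.ofReal ((∑ _k : Fin n, (1 / 4 : ℝ)) ^ (p / 2)) ↔
      y = halfShift Finset.univ x) := by
  have hterm : ∀ k, dist (y k) (x k) ^ 2 ≤ 1 / 4 := fun k => by
    nlinarith [UnitAddCircle.dist_le_half (y k) (x k), dist_nonneg (x := y k) (y := x k)]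
  have hsum := Finset.sum_le_sum fun k (_ : k ∈ Finset.univ) => hterm k
  have h0 : 0 ≤ ∑ k, dist (y k) (x k) ^ 2 := by positivity
  rw [edist_comm, edist_rpow_eq hp.le]
  refine ⟨ENNReal.ofReal_le_ofReal (Real.rpow_le_rpow h0 hsum (by positivity)), ?_⟩
  rw [ENNReal.ofReal_eq_ofReal_iff (by positivity) (Real.rpow_nonneg (h0.trans hsum) _),
    Real.rpow_left_inj h0 (h0.trans hsum) (by positivity),
    Finset.sum_eq_sum_iff_of_le fun k _ => hterm k, eq_halfShift_iff]
  refine ⟨fun h k => ?_, fun h k _ => ?_⟩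
  · have := h k (Finset.mem_univ k)
    rw [if_pos (Finset.mem_univ k)]
    nlinarith [UnitAddCircle.dist_le_half (y k) (x k), dist_nonneg (x := y k) (y := x k)]
  · rw [h k, if_pos (Finset.mem_univ k)]
    norm_num

theorem theorem3p2 (n : ℕ) (hn : 2 ≤ n) (p : ℝ) (hp : 1 ≤ p) :
    WassersteinSpace.IsometricallyRigid p (FlatTorus n) ∧
      Function.Injective (WassersteinSpace.pushforwardHom p (FlatTorus n)) := by
  have hp0 : 0 < p := by linarith
  exact ⟨WassersteinSpace.isometricallyRigid_of_isDiracFixing hp0 ENNReal.ofReal_ne_top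
    (fun x y => (FlatTorus.edist_rpow_le hp0 x y).1)
    (fun x y => (FlatTorus.edist_rpow_le hp0 x y).2) fun _ hF => hF.eq_one hp hn,
    WassersteinSpace.pushforwardHom_injective hp0⟩
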